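/- Consider walks in $\mathbb Z^2$ starting at $(0,0)$, with steps in $\{(1,0),(-1,0),(-1,1),(1,-1)\}$ (East, West, North-West, South-East), all of whose vertices lie in the quarter plane $\{(i,j): i,j\ge 0\}$. Let $q(i,j;n)$ be the number of such walks with $n$ steps ending at $(i,j)$, and put $$q(-,j;n)=\sum_{i\ge0}q(i,j;n),\qquad q(i,-;n)=\sum_{j\ge0}q(i,j;n),\qquad q(-,-;n)=\sum_{i,j\ge0}q(i,j;n)$$ (the numbers of $n$-step walks ending at ordinate $j$, ending at abscissa $i$, and of all $n$-step walks). Let $Q(x,y;t)=\sum_{i,j,n\ge0}q(i,j;n)x^iy^jt^n$. A function $f$ of several natural numbers is *hypergeometric in* one of its variables, $k$, if the ratio of $f$ at $k+1$ to $f$ at $k$ is a rational function of all the variables, i.e. $A\cdot f|_{k+1}=B\cdot f$ on all natural arguments for some nonzero polynomials $A,B$ with rational coefficients in all the variables. It is *Gosper-summable in* $k$ if it is hypergeometric in $k$ and there is a function $g$, hypergeometric in $k$, with $f=g|_{k+1}-g|_{k}$. A *closed form* is a function that is hypergeometric in each of its variables. 1. The numbers $q(i,j;n)$ are Gosper-summable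 in $i$ and in $j$ (note that $q(i,j;n)=0$ unless $i\equiv n \bmod 2$): the functions $q(2i,j;2m)$ and $q(2i+1,j;2m+1)$ of $(m,j,i)$ are Gosper-summable in $i$, and the function $q(i,j;2m+i)$ of $(m,i,j)$ is Gosper-summable in $j$. Hence the sums over intervals have closed form expressions: there are closed forms $G_1,G_2,G_3$ such that for all natural $m,i,j$ and all $i_0\le i_1$, $j_0\le j_1$, $$\sum_{i=i_0}^{i_1}q(i,j;2m)=G_1(m,j,\lfloor i_1/2\rfloor+1)-G_1(m,j,\lceil i_0/2\rceil),$$ $$\sum_{i=i_0}^{i_1}q(i,j;2m+1)=G_2(m,j,\lceil i_1/2\rceil)-G_2(m,j,\lfloor i_0/2\rfloor),$$ $$\sum_{j=j_0}^{j_1}q(i,j;2m+i)=G_3(m,i,j_1+1)-G_3(m,i,j_0).$$ 2. For all $j,m\ge0$, $$q(-,j;2m)=\frac{(j+1)(2m)!(2m+2)!}{(m-j)!(m+1)!^2(m+j+2)!},\qquad q(-,j;2m+1)=\frac{2(j+1)(2m+1)!(2m+2)!}{(m-j)!(m+1)!(m+2)!(m+j+2)!}$$ if $j\le m$, and both numbers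 are $0$ if $j>m$. For all $i,m\ge0$, $$q(i,-;2m+i)=\frac{(i+1)(2m+i)!(2m+i+2)!}{m!(m+1)!(m+i+1)!(m+i+2)!}.$$ In particular, as many $2m$-step walks end on the $x$-axis as on the $y$-axis: $$q(-,0;2m)=q(0,-;2m)=\frac{(2m)!(2m+2)!}{m!(m+1)!^2(m+2)!}.$$ 3. The numbers $q(i,-;n)$ and $q(-,j;n)$ are again Gosper-summable in $i$ and $j$ respectively: the functions $q(2i,-;2m)$ and $q(2i+1,-;2m+1)$ of $(m,i)$ are Gosper-summable in $i$, and the functions $q(-,j;2m)$ and $q(-,j;2m+1)$ of $(m,j)$ are Gosper-summable in $j$. Hence there are closed forms $G_4,\dots,G_7$ such that for all $m$ and all $i_0\le i_1$, $j_0\le j_1$, $$\sum_{i=i_0}^{i_1}q(i,-;2m)=G_4(m,\lfloor i_1/2\rfloor+1)-G_4(m,\lceil i_0/2\rceil),\qquad \sum_{i=i_0}^{i_1}q(i,-;2m+1)=G_5(m,\lceil i_1/2\rceil)-G_5(m,\lfloor i_0/2\rfloor),$$ $$\sum_{j=j_0}^{j_1}q(-,j;2m)=G_6(m,j_1+1)-G_6(m,j_0),\qquad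 \sum_{j=j_0}^{j_1}q(-,j;2m+1)=G_7(m,j_1+1)-G_7(m,j_0).$$ 4. For all $m\ge 0$, $$q(-,-;2m)=\frac{(2m)!(2m+1)!}{m!^2(m+1)!^2},\qquad q(-,-;2m+1)=\frac{(2m+1)!(2m+2)!}{m!(m+1)!^2(m+2)!}.$$ 5. There are positive constants $c_1,c_2,c_3$ such that, as $n\to\infty$, $$q(-,-;n)\sim c_1\,\frac{4^n}{n^2},\qquad q(-,0;n)\sim c_3\,\frac{4^n}{n^3},\qquad q(0,-;n)\sim c_2\,\frac{4^n}{n^3}\ \text{ along even } n$$ ($q(0,-;n)=0$ for odd $n$). 6. The series $Q(1,1;t)$, $Q(0,1;t)$ and $Q(1,0;t)$ are transcendental over $\mathbb Q(t)$. -/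

import Mathlib

open scoped Nat

namespace GouyouBeauchamps

/-- The steps E, W, NW, SE. -/
def steps : Finset (ℤ × ℤ) := {(1, 0), (-1, 0), (-1, 1), (1, -1)}

/-- The position, after `k` steps, of the walk starting at the origin with step sequence `w`. -/
def pos {n : ℕ} (w : Fin n → ℤ × ℤ) (k : ℕ) : ℤ × ℤ :=
  ∑ l : Fin n with l.val < k, w l

/-- The walks with `n` steps, starting at the origin, that always remain in the quarter plane. -/
def walks (n : ℕ) : Finset (Fin n → ℤ × ℤ) :=
  {w ∈ Fintype.piFinset fun _ : Fin n => steps |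
    ∀ k : Fin (n + 1), 0 ≤ (pos w k).1 ∧ 0 ≤ (pos w k).2}

/-- `q(i,j;n)`: the number of `n`-step quarter plane walks ending at `(i,j)`. -/
def q (i j n : ℕ) : ℕ := {w ∈ walks n | pos w n = ((i : ℤ), (j : ℤ))}.card

/-- `q(-,j;n)`: the number of `n`-step quarter plane walks ending at ordinate `j`. -/
def qOrd (j n : ℕ) : ℕ := {w ∈ walks n | (pos w n).2 = (j : ℤ)}.card

/-- `q(i,-;n)`: the number of `n`-step quarter plane walks ending at abscissa `i`. -/
def qAbs (i n : ℕ) : ℕ := {w ∈ walks n | (pos w n).1 = (i : ℤ)}.card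

/-- `q(-,-;n)`: the total number of `n`-step quarter plane walks. -/
def qTot (n : ℕ) : ℕ := (walks n).card

/-- A walk of length `n` cannot end at a point having a coordinate larger than `n`, so that the
sums over `i, j ≤ n` in the generating function below are the sums over all `i, j`. -/
theorem q_eq_zero {i j n : ℕ} (h : n < i ∨ n < j) : q i j n = 0 := by
  unfold q
  rw [Finset.card_eq_zero, Finset.filter_eq_empty_iff]
  intro w hw he
  have hs : ∀ l, w l ∈ steps := by
    have := (Finset.mem_filter.mp hw).1
    simpa [Fintype.mem_piFinset] using this
  have hb : ∀ l, (w l).1 ≤ 1 ∧ (w l).2 ≤ 1 := by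
    intro l
    have := hs l
    simp only [steps, Finset.mem_insert, Finset.mem_singleton] at this
    rcases this with h | h | h | h <;> rw [h] <;> norm_num
  have hp : pos w n = ∑ l, w l := by
    unfold pos
    rw [Finset.filter_true_of_mem]
    intro l _
    exact l.isLt
  have h1 : (pos w n).1 ≤ n := by
    rw [hp, Prod.fst_sum]
    calc ∑ l, (w l).1 ≤ ∑ _l : Fin n, (1 : ℤ) := Finset.sum_le_sum fun l _ => (hb l).1
      _ = n := by simp
  have h2 : (pos w n).2 ≤ n := by
    rw [hp, Prod.snd_sum]
    calc ∑ l, (w l).2 ≤ ∑ _l : Fin n, (1 : ℤ) := Finset.sum_le_sum fun l _ => (hb l).2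
      _ = n := by simp
  rw [he] at h1 h2
  simp only [Nat.cast_le] at h1 h2
  omega

/-- The generating function `Q(x,y;t) = ∑ q(i,j;n) x^i y^j t^n`, as a power series in `t` whose
coefficients are polynomials in `x` (variable `0`) and `y` (variable `1`). -/
noncomputable def Q : PowerSeries (MvPolynomial (Fin 2) ℚ) :=
  PowerSeries.mk fun n => ∑ i ∈ Finset.range (n + 1), ∑ j ∈ Finset.range (n + 1),
    (q i j n : MvPolynomial (Fin 2) ℚ) * MvPolynomial.X 0 ^ i * MvPolynomial.X 1 ^ j

/-- The specialization `Q(a,b;t)`. -/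
noncomputable def QAt (a b : ℚ) : PowerSeries ℚ :=
  PowerSeries.map (MvPolynomial.eval ![a, b]) Q

/-- `f`, a sequence indexed by `r` natural numbers, is hypergeometric in the variable `d`:
the quotient `f(v + e_d) / f(v)` is a rational function of all the variables `v`. As `f` may
vanish, this is written without division. -/
def IsHypergeometricIn {r : ℕ} (d : Fin r) (f : (Fin r → ℕ) → ℚ) : Prop :=
  ∃ A B : MvPolynomial (Fin r) ℚ, A ≠ 0 ∧ B ≠ 0 ∧ ∀ v : Fin r → ℕ,
    MvPolynomial.eval (fun s => (v s : ℚ)) A * f (v + Pi.single d 1) =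
      MvPolynomial.eval (fun s => (v s : ℚ)) B * f v

/-- A closed form term: hypergeometric in each of its variables. -/
def IsHypergeometricTerm {r : ℕ} (f : (Fin r → ℕ) → ℚ) : Prop :=
  ∀ d, IsHypergeometricIn d f

/-- Gosper-summability in the variable `d`, the other variables being symbolic parameters. -/
def GosperSummableIn {r : ℕ} (d : Fin r) (f : (Fin r → ℕ) → ℚ) : Prop :=
  IsHypergeometricIn d f ∧ ∃ g : (Fin r → ℕ) → ℚ, IsHypergeometricIn d g ∧
    ∀ v, f v = g (v + Pi.single d 1) - g v

end GouyouBeauchamps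

open GouyouBeauchamps

/-! ### Step-by-step recurrence and the closed form of q(i,j;n) -/

namespace GouyouBeauchamps

/-! Everything rests on the explicit product formula `walkFormula` for q(i,j;2m+i). Removing the
last step of a walk gives a four-term recurrence on the quadrant with zero values on the lines i =
-1 and j = -1. The formula vanishes on these lines through its factors (i+1)(j+1). It satisfies the
same recurrence because, once all factorials are reduced to common ones, the recurrence is a
polynomial identity. Reading 1/k! as 0 for negative k makes this uniform, without boundary cases.

Gosper-summability is shown by exhibiting the antidifferences (`tailEvenAbs`, `tailOddAbs`,
`tailOrd`); each telescoping relation is again a polynomial identity. They vanish far out, so a sum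
over all i or j is minus the value at 0. This gives the marginals, which are again Gosper-summable,
and a second telescoping gives the total. The asymptotics follow from the Wallis product, since
every count concerned is 16^m / W(m) times a rational function of m.

For transcendence, let K = ∑ binom(2m,m)² X^(2m). By Lucas, modulo an odd prime p one has K = T
K(X^p) = T K^p, where T is K truncated below degree p; thus 1/K is a (p-1)-th root of the polynomial
T. Truncation preserves the second-order differential equation of K modulo p, and this equation
forces the roots of T to be simple. At such a root Y^(p-1) - T is Eisenstein, so 1/K has degree p-1
modulo p. An algebraic equation for K over ℤ[X] would bound this degree for all large p, which is
absurd. Finally, K is recovered from the even part of each of the three generating functions by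
multiplying coefficients by polynomials in m, shifting and taking linear combinations; all these
operations preserve algebraicity. -/

theorem pos_snoc {n : ℕ} (w : Fin n → ℤ × ℤ) (s : ℤ × ℤ) {k : ℕ} (hk : k ≤ n) :
    pos (Fin.snoc w s : Fin (n + 1) → ℤ × ℤ) k = pos w k := by
  unfold pos
  rw [Finset.sum_filter, Finset.sum_filter, Fin.sum_univ_castSucc]
  simp [hk]

theorem pos_self {n : ℕ} (w : Fin n → ℤ × ℤ) : pos w n = ∑ l, w l := by
  unfold pos
  rw [Finset.filter_true_of_mem fun l _ => l.isLt]

theorem pos_snoc_last {n : ℕ} (w : Fin n → ℤ × ℤ) (s : ℤ × ℤ) :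
    pos (Fin.snoc w s : Fin (n + 1) → ℤ × ℤ) (n + 1) = pos w n + s := by
  rw [pos_self, pos_self, Fin.sum_univ_castSucc]
  simp

theorem mem_walks {n : ℕ} (w : Fin n → ℤ × ℤ) :
    w ∈ walks n ↔ (∀ l, w l ∈ steps) ∧ ∀ k ≤ n, 0 ≤ (pos w k).1 ∧ 0 ≤ (pos w k).2 := by
  simp only [walks, Finset.mem_filter, Fintype.mem_piFinset]
  refine and_congr_right fun _ => ⟨fun h k hk => ?_, fun h k => h k (Nat.lt_succ_iff.mp k.isLt)⟩
  simpa using h ⟨k, Nat.lt_succ_of_le hk⟩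

theorem snoc_mem_walks {n : ℕ} (w : Fin n → ℤ × ℤ) (s : ℤ × ℤ) :
    (Fin.snoc w s : Fin (n + 1) → ℤ × ℤ) ∈ walks (n + 1) ↔
      w ∈ walks n ∧ s ∈ steps ∧ 0 ≤ (pos w n + s).1 ∧ 0 ≤ (pos w n + s).2 := by
  rw [mem_walks, mem_walks]
  constructor
  · rintro ⟨h1, h2⟩
    refine ⟨⟨fun l => ?_, fun k hk => ?_⟩, ?_, ?_⟩
    · simpa using h1 l.castSucc
    · simpa [pos_snoc w s hk] using h2 k (by omega)
    · simpa using h1 (Fin.last n)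
    · simpa only [pos_snoc_last] using h2 (n + 1) le_rfl
  · rintro ⟨⟨h1, h2⟩, h3, h4⟩
    refine ⟨fun l => ?_, fun k hk => ?_⟩
    · refine Fin.lastCases ?_ (fun l => ?_) l
      · simpa using h3
      · simpa using h1 l
    · rcases Nat.lt_or_ge n k with h | h
      · obtain rfl : k = n + 1 := by omega
        rwa [pos_snoc_last]
      · rw [pos_snoc w s h]
        exact h2 k h

/-- The number of `n`-step quarter plane walks ending at a point of `ℤ × ℤ`. -/
def walkCount (n : ℕ) (x : ℤ × ℤ) : ℕ := {w ∈ walks n | pos w n = x}.card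

/-- Walks are sorted by their last step. The endpoint must lie in the quadrant, since otherwise the
shortened walk could still be admissible. -/
theorem walkCount_succ (n : ℕ) {x : ℤ × ℤ} (h1 : 0 ≤ x.1) (h2 : 0 ≤ x.2) :
    walkCount (n + 1) x = ∑ s ∈ steps, walkCount n (x - s) := by
  unfold walkCount
  rw [Finset.card_eq_sum_card_fiberwise (f := fun w => w (Fin.last n)) (t := steps)]
  · refine Finset.sum_congr rfl fun s hs => ?_
    refine Finset.card_nbij' (fun w => Fin.init w)
      (fun w => (Fin.snoc w s : Fin (n + 1) → ℤ × ℤ)) ?_ ?_ ?_ ?_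
    · intro w hw
      simp only [Finset.coe_filter, Set.mem_ofPred_eq, Finset.mem_filter] at hw ⊢
      obtain ⟨⟨hw, hx⟩, hs'⟩ := hw
      rw [← Fin.snoc_init_self w, hs'] at hw hx
      rw [snoc_mem_walks] at hw
      rw [pos_snoc_last] at hx
      exact ⟨hw.1, by rw [← hx]; simp⟩
    · intro w hw
      simp only [Finset.coe_filter, Set.mem_ofPred_eq, Finset.mem_filter] at hw ⊢
      rw [snoc_mem_walks, pos_snoc_last, hw.2]
      simp [hw.1, hs, h1, h2]
    · intro w hw
      simp only [Finset.coe_filter, Set.mem_ofPred_eq, Finset.mem_filter] at hw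
      simp only [← hw.2]
      exact Fin.snoc_init_self w
    · intro w _
      simp
  · intro w hw
    simp only [Finset.coe_filter, Set.mem_ofPred_eq] at hw
    exact ((mem_walks w).1 hw.1).1 _

theorem walkCount_of_neg (n : ℕ) {x : ℤ × ℤ} (h : x.1 < 0 ∨ x.2 < 0) : walkCount n x = 0 := by
  unfold walkCount
  rw [Finset.card_eq_zero, Finset.filter_eq_empty_iff]
  rintro w hw rfl
  have := ((mem_walks w).1 hw).2 n le_rfl
  omega

theorem walkCount_zero (x : ℤ × ℤ) : walkCount 0 x = if x = 0 then 1 else 0 := by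
  unfold walkCount
  have h : walks 0 = Finset.univ := by
    ext w
    simpa [mem_walks, pos] using Subsingleton.elim _ _
  rw [h]
  split_ifs with hx
  · subst hx
    simp [pos]
  · simp [pos, Ne.symm hx]

theorem walkCount_recurrence (n : ℕ) {i j : ℤ} (hi : 0 ≤ i) (hj : 0 ≤ j) :
    walkCount (n + 1) (i, j) = walkCount n (i - 1, j) + walkCount n (i + 1, j) +
      walkCount n (i + 1, j - 1) + walkCount n (i - 1, j + 1) := by
  rw [walkCount_succ n (by simpa using hi) (by simpa using hj)]
  simp only [steps]
  rw [Finset.sum_insert (by decide), Finset.sum_insert (by decide), Finset.sum_insert (by decide),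
    Finset.sum_singleton]
  simp only [Prod.mk_sub_mk, sub_neg_eq_add, sub_zero]
  ring

/-- `1 / k!`, with the value `0` for negative `k`. -/
def rfac (k : ℤ) : ℚ := if k < 0 then 0 else ((k.toNat)! : ℚ)⁻¹

/-- `k!` for an integer `k ≥ 0`. -/
def zfac (k : ℤ) : ℚ := ((k.toNat)! : ℚ)

theorem rfac_natCast (k : ℕ) : rfac k = ((k)! : ℚ)⁻¹ := by
  simp [rfac]

theorem zfac_natCast (k : ℕ) : zfac k = ((k)! : ℚ) := by
  simp [zfac]

theorem rfac_of_neg {k : ℤ} (h : k < 0) : rfac k = 0 := by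
  simp [rfac, h]

/-- At k = -1 both sides vanish, the factor k + 1 absorbing the jump to 1/0!. Validity for every
integer is what lets later identities be checked by `ring` with no case distinction. -/
theorem rfac_eq_succ_mul (k : ℤ) : rfac k = (k + 1) * rfac (k + 1) := by
  rcases lt_trichotomy k (-1) with h | h | h
  · rw [rfac_of_neg (by omega), rfac_of_neg (by omega), mul_zero]
  · subst h
    simp [rfac]
  · obtain ⟨n, rfl⟩ := Int.eq_ofNat_of_zero_le (show 0 ≤ k by omega)
    rw [show (n : ℤ) + 1 = ((n + 1 : ℕ) : ℤ) by push_cast; ring, rfac_natCast, rfac_natCast,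
      Nat.factorial_succ]
    have : ((n)! : ℚ) ≠ 0 := by exact_mod_cast (Nat.factorial_pos n).ne'
    push_cast
    field_simp

theorem rfac_eq_mul {k l : ℤ} (h : l = k + 1) : rfac k = l * rfac l := by
  subst h
  exact_mod_cast rfac_eq_succ_mul k

theorem zfac_succ {k : ℤ} (h : 0 ≤ k) : zfac (k + 1) = (k + 1) * zfac k := by
  obtain ⟨n, rfl⟩ := Int.eq_ofNat_of_zero_le h
  rw [show (n : ℤ) + 1 = ((n + 1 : ℕ) : ℤ) by push_cast; ring, zfac_natCast, zfac_natCast,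
      Nat.factorial_succ]
  push_cast
  ring

theorem zfac_eq_mul {k l : ℤ} (hk : 0 ≤ k) (h : l = k + 1) : zfac l = l * zfac k := by
  subst h
  exact_mod_cast zfac_succ hk

/-- The closed form of `q(i,j;2m+i)`, for integers `i, j, m`. -/
def walkFormula (m i j : ℤ) : ℚ :=
  (i + 1) * (j + 1) * (i + j + 2) * (i + 2 * j + 3) * zfac (2 * m + i) * zfac (2 * m + i + 2) *
    rfac (m - j) * rfac (m + 1) * rfac (m + i + 2) * rfac (m + i + j + 3)

/-- All factorials are reduced to common ones, leaving a polynomial identity. The hypothesis makes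
2m+i-1, the smallest argument of `zfac`, nonnegative. -/
theorem walkFormula_recurrence {m i j : ℤ} (h : 1 ≤ 2 * m + i) :
    walkFormula m i j = walkFormula m (i - 1) j + walkFormula (m - 1) (i + 1) j +
      walkFormula (m - 1) (i + 1) (j - 1) + walkFormula m (i - 1) (j + 1) := by
  unfold walkFormula
  rw [show 2 * (m - 1) + (i + 1) = 2 * m + i - 1 by ring,
    show 2 * m + i - 1 + 2 = 2 * m + i + 1 by ring,
    show 2 * m + (i - 1) = 2 * m + i - 1 by ring,
    show 2 * m + i - 1 + 2 = 2 * m + i + 1 by ring,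
    zfac_eq_mul (k := 2 * m + i - 1) (l := 2 * m + i) (by omega) (by ring),
    zfac_eq_mul (k := 2 * m + i + 1) (l := 2 * m + i + 2) (by omega) (by ring),
    show m + (i - 1) + 2 = m + i + 1 by ring, show m + (i - 1) + j + 3 = m + i + j + 2 by ring,
    show m - 1 - j = m - j - 1 by ring, show m - 1 + 1 = m by ring,
    show m - 1 + (i + 1) + 2 = m + i + 2 by ring,
    show m - 1 + (i + 1) + j + 3 = m + i + j + 3 by ring,
    show m - 1 - (j - 1) = m - j by ring,
    show m - 1 + (i + 1) + (j - 1) + 3 = m + i + j + 2 by ring,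
    show m - (j + 1) = m - j - 1 by ring,
    show m + (i - 1) + (j + 1) + 3 = m + i + j + 3 by ring,
    rfac_eq_mul (k := m - j - 1) (l := m - j) (by ring),
    rfac_eq_mul (k := m) (l := m + 1) (by ring),
    rfac_eq_mul (k := m + i + 1) (l := m + i + 2) (by ring),
    rfac_eq_mul (k := m + i + j + 2) (l := m + i + j + 3) (by ring)]
  push_cast
  ring

/-- The range starts at -1 so that all four neighbours of a point of the quadrant fall under the
induction hypothesis. The parameter m is an integer because it may be negative when i > n. -/
theorem walkCount_eq_walkFormula (n : ℕ) : ∀ m i j : ℤ, -1 ≤ i → -1 ≤ j → (n : ℤ) = 2 * m + i →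
    (walkCount n (i, j) : ℚ) = walkFormula m i j := by
  induction n with
  | zero =>
    intro m i j hi hj h
    rw [walkCount_zero]
    rcases eq_or_lt_of_le hj with hj | hj
    · subst hj
      simp [walkFormula]
    · rcases lt_trichotomy m j with hm | hm | hm
      · rw [if_neg (by simp; omega)]
        simp [walkFormula, rfac_of_neg (show m - j < 0 by omega)]
      -- Here i = -2m ≥ -1 and m = j ≥ 0, which leaves only the origin.
      · obtain ⟨rfl, rfl, rfl⟩ : m = 0 ∧ i = 0 ∧ j = 0 := by omega
        simp [walkFormula, rfac, zfac]
        norm_num [Nat.factorial]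
      · omega
  | succ n ih =>
    intro m i j hi hj h
    rcases eq_or_lt_of_le hi with hi | hi
    · rw [walkCount_of_neg _ (by simp; omega)]
      simp [walkFormula, ← hi]
    rcases eq_or_lt_of_le hj with hj | hj
    · rw [walkCount_of_neg _ (by simp; omega)]
      simp [walkFormula, ← hj]
    rw [walkCount_recurrence n (by omega) (by omega), walkFormula_recurrence (by push_cast at h; omega)]
    push_cast at h ⊢
    rw [ih m (i - 1) j (by omega) (by omega) (by omega),
      ih (m - 1) (i + 1) j (by omega) (by omega) (by omega),
      ih (m - 1) (i + 1) (j - 1) (by omega) (by omega) (by omega),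
      ih m (i - 1) (j + 1) (by omega) (by omega) (by omega)]

theorem walkCount_eq_zero_of_parity (n : ℕ) : ∀ i j : ℤ, (n - i) % 2 = 1 →
    walkCount n (i, j) = 0 := by
  induction n with
  | zero =>
    intro i j h
    rw [walkCount_zero, if_neg (by simp; omega)]
  | succ n ih =>
    intro i j h
    by_cases hi : i < 0
    · exact walkCount_of_neg _ (Or.inl hi)
    by_cases hj : j < 0
    · exact walkCount_of_neg _ (Or.inr hj)
    push_cast at h
    rw [walkCount_recurrence n (by omega) (by omega), ih _ _ (by omega), ih _ _ (by omega),
      ih _ _ (by omega), ih _ _ (by omega)]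

theorem q_eq_walkFormula {i j n : ℕ} (m : ℤ) (h : (n : ℤ) = 2 * m + i) :
    (q i j n : ℚ) = walkFormula m i j :=
  walkCount_eq_walkFormula n m i j (by omega) (by omega) h

theorem q_eq_zero_of_parity {i j n : ℕ} (h : ((n : ℤ) - i) % 2 = 1) : q i j n = 0 :=
  walkCount_eq_zero_of_parity n i j h

/-! ### Marginals as finite sums -/

theorem pos_bounds {n : ℕ} {w : Fin n → ℤ × ℤ} (hw : w ∈ walks n) :
    ∃ i j : ℕ, pos w n = ((i : ℤ), (j : ℤ)) := by
  obtain ⟨h1, h2⟩ := ((mem_walks w).1 hw).2 n le_rfl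
  obtain ⟨i, hi⟩ := Int.eq_ofNat_of_zero_le h1
  obtain ⟨j, hj⟩ := Int.eq_ofNat_of_zero_le h2
  exact ⟨i, j, Prod.ext hi hj⟩

theorem pos_le {n : ℕ} {w : Fin n → ℤ × ℤ} (hw : w ∈ walks n) {i j : ℕ}
    (h : pos w n = ((i : ℤ), (j : ℤ))) : i ≤ n ∧ j ≤ n := by
  by_contra hc
  have h0 : q i j n = 0 := q_eq_zero (by omega)
  rw [q, Finset.card_eq_zero, Finset.filter_eq_empty_iff] at h0
  exact h0 hw h

theorem qOrd_eq_sum (j n : ℕ) : qOrd j n = ∑ i ∈ Finset.range (n + 1), q i j n := by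
  unfold qOrd
  rw [Finset.card_eq_sum_card_fiberwise (f := fun w => (pos w n).1.toNat)
    (t := Finset.range (n + 1))]
  · refine Finset.sum_congr rfl fun i _ => ?_
    rw [q, Finset.filter_filter]
    congr 1
    refine Finset.filter_congr fun w hw => ?_
    obtain ⟨a, b, hab⟩ := pos_bounds hw
    simp [hab, and_comm]
  · intro w hw
    simp only [Finset.coe_filter, Set.mem_ofPred_eq] at hw
    obtain ⟨a, b, hab⟩ := pos_bounds hw.1
    have := pos_le hw.1 hab
    simp [hab]
    omega

theorem qAbs_eq_sum (i n : ℕ) : qAbs i n = ∑ j ∈ Finset.range (n + 1), q i j n := by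
  unfold qAbs
  rw [Finset.card_eq_sum_card_fiberwise (f := fun w => (pos w n).2.toNat)
    (t := Finset.range (n + 1))]
  · refine Finset.sum_congr rfl fun j _ => ?_
    rw [q, Finset.filter_filter]
    congr 1
    refine Finset.filter_congr fun w hw => ?_
    obtain ⟨a, b, hab⟩ := pos_bounds hw
    simp [hab]
  · intro w hw
    simp only [Finset.coe_filter, Set.mem_ofPred_eq] at hw
    obtain ⟨a, b, hab⟩ := pos_bounds hw.1
    have := pos_le hw.1 hab
    simp [hab]
    omega

theorem qTot_eq_sum_qOrd (n : ℕ) : qTot n = ∑ j ∈ Finset.range (n + 1), qOrd j n := by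
  unfold qTot
  rw [Finset.card_eq_sum_card_fiberwise (f := fun w => (pos w n).2.toNat)
    (t := Finset.range (n + 1))]
  · refine Finset.sum_congr rfl fun j _ => ?_
    rw [qOrd]
    congr 1
    refine Finset.filter_congr fun w hw => ?_
    obtain ⟨a, b, hab⟩ := pos_bounds hw
    simp [hab]
  · intro w hw
    obtain ⟨a, b, hab⟩ := pos_bounds hw
    have := pos_le hw hab
    simp [hab]
    omega

theorem hasSum_qOrd (j n : ℕ) : HasSum (fun i => q i j n) (qOrd j n) := by
  rw [qOrd_eq_sum]
  refine hasSum_sum_of_ne_finset_zero (s := Finset.range (n + 1)) fun i hi => q_eq_zero (Or.inl ?_)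
  rw [Finset.mem_range] at hi
  omega

theorem hasSum_qAbs (i n : ℕ) : HasSum (fun j => q i j n) (qAbs i n) := by
  rw [qAbs_eq_sum]
  refine hasSum_sum_of_ne_finset_zero (s := Finset.range (n + 1)) fun i hi => q_eq_zero (Or.inr ?_)
  rw [Finset.mem_range] at hi
  omega

theorem qTot_eq_sum (n : ℕ) :
    qTot n = ∑ p ∈ Finset.range (n + 1) ×ˢ Finset.range (n + 1), q p.1 p.2 n := by
  rw [qTot_eq_sum_qOrd, Finset.sum_product_right]
  exact Finset.sum_congr rfl fun j _ => qOrd_eq_sum j n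

theorem hasSum_qTot (n : ℕ) : HasSum (fun p : ℕ × ℕ => q p.1 p.2 n) (qTot n) := by
  rw [qTot_eq_sum]
  refine hasSum_sum_of_ne_finset_zero fun p hp => q_eq_zero ?_
  simp only [Finset.mem_product, Finset.mem_range] at hp
  omega

end GouyouBeauchamps

/-! ### Hypergeometric terms and telescoping sums -/

namespace GouyouBeauchamps

open MvPolynomial

variable {r : ℕ} {d : Fin r}

theorem IsHypergeometricIn.mul {f g : (Fin r → ℕ) → ℚ} (hf : IsHypergeometricIn d f)
    (hg : IsHypergeometricIn d g) : IsHypergeometricIn d fun v => f v * g v := by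
  obtain ⟨A, B, hA, hB, h⟩ := hf
  obtain ⟨A', B', hA', hB', h'⟩ := hg
  refine ⟨A * A', B * B', mul_ne_zero hA hA', mul_ne_zero hB hB', fun v => ?_⟩
  rw [map_mul, map_mul, mul_mul_mul_comm, h, h', mul_mul_mul_comm]

/-- The ratio is that of the shifted polynomial to p. The shift is an invertible substitution, with
inverse `τ`, so the shifted polynomial is nonzero too. -/
theorem isHypergeometricIn_eval {p : MvPolynomial (Fin r) ℚ} (hp : p ≠ 0) :
    IsHypergeometricIn d fun v => eval (fun s => (v s : ℚ)) p := by
  set σ : Fin r → MvPolynomial (Fin r) ℚ := fun s => X s + C ((Pi.single d 1 : Fin r → ℚ) s) with hσ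
  set τ : Fin r → MvPolynomial (Fin r) ℚ := fun s => X s - C ((Pi.single d 1 : Fin r → ℚ) s) with hτ
  have key : aeval τ (aeval σ p) = p := by
    have : (aeval τ).comp (aeval σ) = AlgHom.id ℚ (MvPolynomial (Fin r) ℚ) := by
      ext s : 1
      simp [hσ, hτ]
    exact DFunLike.congr_fun this p
  refine ⟨p, aeval σ p, hp, ?_, fun v => ?_⟩
  · intro h
    rw [h, map_zero] at key
    exact hp key.symm
  · have : eval (fun s => (v s : ℚ)) (aeval σ p) =
        eval (fun s => ((v + Pi.single d 1 : Fin r → ℕ) s : ℚ)) p := by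
      rw [← coe_aeval_eq_eval, RingHom.coe_coe, ← AlgHom.comp_apply, comp_aeval,
        ← coe_aeval_eq_eval, RingHom.coe_coe]
      congr 2
      ext s
      rcases eq_or_ne s d with rfl | hs
      · simp [hσ]
      · simp [hσ, hs]
    rw [this, mul_comm]

/-- The value at `v` of the linear form with coefficients `c` and constant term `b`. -/
def linVal (c : Fin r → ℤ) (b : ℤ) (v : Fin r → ℕ) : ℤ := ∑ s, c s * v s + b

theorem linVal_add_single (c : Fin r → ℤ) (b : ℤ) (v : Fin r → ℕ) :
    linVal c b (v + Pi.single d 1) = linVal c b v + c d := by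
  simp only [linVal, Pi.add_apply, Nat.cast_add, mul_add, Finset.sum_add_distrib]
  have : ∑ s, c s * ((Pi.single d 1 : Fin r → ℕ) s : ℤ) = c d := by
    rw [Finset.sum_eq_single d]
    · simp
    · intro s _ hs
      simp [hs]
    · simp
  rw [this]
  ring

/-- A linear form whose coefficient `c d` is nonzero changes along the direction d, so it is not the
zero polynomial. For n = 0 the product is empty and nothing is needed. -/
theorem exists_prod_linVal (c : Fin r → ℤ) (n : ℕ) (b : ℕ → ℤ) (h : n ≠ 0 → c d ≠ 0) :
    ∃ p : MvPolynomial (Fin r) ℚ, p ≠ 0 ∧ ∀ v : Fin r → ℕ,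
      eval (fun s => (v s : ℚ)) p = ∏ t ∈ Finset.range n, (linVal c (b t) v : ℚ) := by
  refine ⟨∏ t ∈ Finset.range n, (∑ s, C (c s : ℚ) * X s + C (b t : ℚ)), ?_, fun v => ?_⟩
  · rw [Finset.prod_ne_zero_iff]
    intro t ht h0
    have hn : n ≠ 0 := by
      rintro rfl
      simp at ht
    have e : ∀ v : Fin r → ℕ, (linVal c (b t) v : ℚ) = 0 := fun v => by
      have := congrArg (eval fun s => (v s : ℚ)) h0
      simpa [linVal] using this
    have h1 := e 0
    have h2 := e (0 + Pi.single d 1)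
    rw [linVal_add_single] at h2
    push_cast at h2
    rw [h1, zero_add] at h2
    exact h hn (by exact_mod_cast h2)
  · simp [linVal]

theorem rfac_eq_prod (k : ℤ) (n : ℕ) :
    rfac k = (∏ t ∈ Finset.range n, ((k + (t + 1) : ℤ) : ℚ)) * rfac (k + n) := by
  induction n with
  | zero => simp
  | succ n ih =>
    rw [ih, Finset.prod_range_succ, rfac_eq_succ_mul]
    push_cast
    ring_nf

theorem zfac_eq_prod {k : ℤ} (hk : 0 ≤ k) (n : ℕ) :
    zfac (k + n) = (∏ t ∈ Finset.range n, ((k + (t + 1) : ℤ) : ℚ)) * zfac k := by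
  induction n with
  | zero => simp
  | succ n ih =>
    rw [show k + ((n + 1 : ℕ) : ℤ) = k + n + 1 by push_cast; ring, zfac_succ (by omega), ih,
      Finset.prod_range_succ]
    push_cast
    ring

theorem linVal_add (c : Fin r → ℤ) (a b : ℤ) (v : Fin r → ℕ) :
    linVal c (a + b) v = linVal c a v + b := by
  simp [linVal, add_assoc]

/-- A unit shift moves the argument by `c d`, which costs |c d| linear factors. The sign of `c d`
decides on which side of the relation they appear. -/
theorem isHypergeometricIn_rfac (c : Fin r → ℤ) (b : ℤ) :
    IsHypergeometricIn d fun v => rfac (linVal c b v) := by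
  rcases Int.le_total 0 (c d) with h | h
  · obtain ⟨n, hn⟩ := Int.eq_ofNat_of_zero_le h
    obtain ⟨p, hp, hpv⟩ := exists_prod_linVal (d := d) c n (fun t => b + (t + 1)) (by omega)
    refine ⟨p, 1, hp, one_ne_zero, fun v => ?_⟩
    beta_reduce
    rw [linVal_add_single, hpv, map_one, one_mul, rfac_eq_prod (linVal c b v) n, hn]
    simp only [linVal_add]
  · obtain ⟨n, hn⟩ := Int.eq_ofNat_of_zero_le (show 0 ≤ -c d by omega)
    obtain ⟨p, hp, hpv⟩ := exists_prod_linVal (d := d) c n (fun t => b + (c d + (t + 1)))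
      (by omega)
    refine ⟨1, p, one_ne_zero, hp, fun v => ?_⟩
    beta_reduce
    rw [linVal_add_single, hpv, map_one, one_mul, rfac_eq_prod (linVal c b v + c d) n,
      show linVal c b v + c d + (n : ℤ) = linVal c b v by
        rw [← hn]; ring]
    simp only [linVal_add, add_assoc]

theorem isHypergeometricIn_zfac {c : Fin r → ℤ} {b : ℤ} (hc : ∀ s, 0 ≤ c s) (hb : 0 ≤ b) :
    IsHypergeometricIn d fun v => zfac (linVal c b v) := by
  obtain ⟨n, hn⟩ := Int.eq_ofNat_of_zero_le (hc d)
  obtain ⟨p, hp, hpv⟩ := exists_prod_linVal (d := d) c n (fun t => b + (t + 1)) (by omega)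
  refine ⟨1, p, one_ne_zero, hp, fun v => ?_⟩
  have h0 : 0 ≤ linVal c b v :=
    add_nonneg (Finset.sum_nonneg fun s _ => mul_nonneg (hc s) (by positivity)) hb
  beta_reduce
  rw [linVal_add_single, hpv, map_one, one_mul, hn, zfac_eq_prod h0]
  simp only [linVal_add]

theorem isHypergeometricIn_list_prod {ι : Type*} {F : ι → (Fin r → ℕ) → ℚ} (L : List ι)
    (h : ∀ z ∈ L, IsHypergeometricIn d (F z)) :
    IsHypergeometricIn d fun v => (L.map fun z => F z v).prod := by
  induction L with
  | nil => exact ⟨1, 1, one_ne_zero, one_ne_zero, fun v => by simp⟩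
  | cons z L ih =>
    simp only [List.map_cons, List.prod_cons]
    exact (h z (by simp)).mul (ih fun w hw => h w (by simp [hw]))

/-- Products of a polynomial, of factorials and of inverse factorials of linear forms are closed
forms. -/
theorem isHypergeometricTerm_of_eq {f : (Fin r → ℕ) → ℚ} (p : MvPolynomial (Fin r) ℚ)
    (Z R : List ((Fin r → ℤ) × ℤ)) (hp : eval (fun _ => 1) p ≠ 0)
    (hZ : ∀ z ∈ Z, (∀ s, 0 ≤ z.1 s) ∧ 0 ≤ z.2)
    (h : ∀ v, f v = eval (fun s => (v s : ℚ)) p * (Z.map fun z => zfac (linVal z.1 z.2 v)).prod *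
      (R.map fun z => rfac (linVal z.1 z.2 v)).prod) :
    IsHypergeometricTerm f := by
  intro d
  rw [funext h]
  refine ((isHypergeometricIn_eval ?_).mul ?_).mul ?_
  -- The nonzero value at (1,…,1) serves as a numerical certificate that p ≠ 0.
  · rintro rfl
    simp at hp
  · exact isHypergeometricIn_list_prod Z fun z hz =>
      isHypergeometricIn_zfac (hZ z hz).1 (hZ z hz).2
  · exact isHypergeometricIn_list_prod R fun z _ => isHypergeometricIn_rfac z.1 z.2

theorem sum_Icc_eq_sub {u g : ℕ → ℚ} (h : ∀ k, u k = g (k + 1) - g k) {a b : ℕ} (hab : a ≤ b) :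
    ∑ k ∈ Finset.Icc a b, u k = g (b + 1) - g a := by
  induction b, hab using Nat.le_induction with
  | base => simp [h]
  | succ b hab ih =>
    rw [Finset.sum_Icc_succ_top (by omega), ih, h]
    ring

/-- Since the odd terms vanish, k ↦ g(⌈k/2⌉) is an antidifference of the whole sequence. -/
theorem sum_Icc_even_eq_sub {u g : ℕ → ℚ} (h0 : ∀ k, u (2 * k + 1) = 0)
    (h : ∀ k, u (2 * k) = g (k + 1) - g k) {a b : ℕ} (hab : a ≤ b) :
    ∑ k ∈ Finset.Icc a b, u k = g (b / 2 + 1) - g ((a + 1) / 2) := by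
  refine (sum_Icc_eq_sub (g := fun k => g ((k + 1) / 2)) (fun k => ?_) hab).trans ?_
  · rcases Nat.even_or_odd' k with ⟨l, rfl | rfl⟩
    · rw [h, show (2 * l + 1 + 1) / 2 = l + 1 by omega, show (2 * l + 1) / 2 = l by omega]
    · rw [h0, show (2 * l + 1 + 1 + 1) / 2 = (2 * l + 1 + 1) / 2 by omega, sub_self]
  · rw [show (b + 1 + 1) / 2 = b / 2 + 1 by omega]

theorem sum_Icc_odd_eq_sub {u g : ℕ → ℚ} (h0 : ∀ k, u (2 * k) = 0)
    (h : ∀ k, u (2 * k + 1) = g (k + 1) - g k) {a b : ℕ} (hab : a ≤ b) :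
    ∑ k ∈ Finset.Icc a b, u k = g ((b + 1) / 2) - g (a / 2) := by
  refine sum_Icc_eq_sub (g := fun k => g (k / 2)) (fun k => ?_) hab
  rcases Nat.even_or_odd' k with ⟨l, rfl | rfl⟩
  · rw [h0, show (2 * l + 1) / 2 = 2 * l / 2 by omega, sub_self]
  · rw [h, show (2 * l + 1 + 1) / 2 = l + 1 by omega, show (2 * l + 1) / 2 = l by omega]

end GouyouBeauchamps

/-! ### Gosper antidifferences and the marginal counts -/

namespace GouyouBeauchamps

open MvPolynomial

/-- `-∑ q(i,j;2m)` over `i ≥ 2k`. -/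
def tailEvenAbs (m j k : ℤ) : ℚ :=
  -2 * (j + 1) * (m + 1 + 2 * k * (k + j + 1)) * zfac (2 * m) * zfac (2 * m + 1) *
    rfac (m - k - j) * rfac (m - k + 1) * rfac (m + k + 1) * rfac (m + k + j + 2)

/-- `-∑ q(i,j;2m+1)` over `i ≥ 2k+1`. -/
def tailOddAbs (m j k : ℤ) : ℚ :=
  -(j + 1) * (4 * k ^ 2 + 4 * (j + 2) * k + 2 * m + 2 * j + 6) *
    zfac (2 * m + 1) * zfac (2 * m + 2) *
    rfac (m - k - j) * rfac (m - k + 1) * rfac (m + k + 2) * rfac (m + k + j + 3)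

/-- `-∑ q(i,l;2m+i)` over `l ≥ j`. -/
def tailOrd (m i j : ℤ) : ℚ :=
  -(i + 1) * (j ^ 2 + (i + 2) * j + m + i + 2) * zfac (2 * m + i) * zfac (2 * m + i + 2) *
    rfac (m - j) * rfac (m + 1) * rfac (m + i + 2) * rfac (m + i + j + 2)

/-- The closed form of `q(-,j;2m)`. -/
def ordEven (m j : ℤ) : ℚ :=
  (j + 1) * zfac (2 * m) * zfac (2 * m + 2) *
    rfac (m - j) * rfac (m + 1) ^ 2 * rfac (m + j + 2)

/-- The closed form of `q(-,j;2m+1)`. -/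
def ordOdd (m j : ℤ) : ℚ :=
  2 * (j + 1) * zfac (2 * m + 1) * zfac (2 * m + 2) *
    rfac (m - j) * rfac (m + 1) * rfac (m + 2) * rfac (m + j + 2)

/-- The closed form of `q(i,-;2m+i)`. -/
def absFormula (m i : ℤ) : ℚ :=
  (i + 1) * zfac (2 * m + i) * zfac (2 * m + i + 2) *
    rfac m * rfac (m + 1) * rfac (m + i + 1) * rfac (m + i + 2)

/-- `-∑ q(i,-;2m)` over `i ≥ 2k`. -/
def tailAbsEven (m k : ℤ) : ℚ :=
  -zfac (2 * m) * zfac (2 * m + 1) *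
    rfac (m - k) * rfac (m - k + 1) * rfac (m + k) * rfac (m + k + 1)

/-- `-∑ q(i,-;2m+1)` over `i ≥ 2k+1`. -/
def tailAbsOdd (m k : ℤ) : ℚ :=
  -zfac (2 * m + 1) * zfac (2 * m + 2) *
    rfac (m - k) * rfac (m - k + 1) * rfac (m + k + 1) * rfac (m + k + 2)

/-- `-∑ q(-,l;2m)` over `l ≥ j`. -/
def tailOrdEven (m j : ℤ) : ℚ :=
  -(1 / 2) * zfac (2 * m) * zfac (2 * m + 2) * rfac (m + 1) ^ 2 * rfac (m - j) * rfac (m + j + 1)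

/-- `-∑ q(-,l;2m+1)` over `l ≥ j`. -/
def tailOrdOdd (m j : ℤ) : ℚ :=
  -zfac (2 * m + 1) * zfac (2 * m + 2) * rfac (m + 1) * rfac (m + 2) *
    rfac (m - j) * rfac (m + j + 1)

/-- Both values of the tail and the summand reduce to the same factorials, and a polynomial identity
remains. The other telescoping relations below are verified in the same way. -/
theorem tailEvenAbs_sub {m j k : ℤ} (hm : 0 ≤ m) :
    walkFormula (m - k) (2 * k) j = tailEvenAbs m j (k + 1) - tailEvenAbs m j k := by
  unfold walkFormula tailEvenAbs
  rw [show 2 * (m - k) + 2 * k = 2 * m by ring,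
    zfac_eq_mul (k := 2 * m + 1) (l := 2 * m + 2) (by omega) (by ring),
    show m - k + 2 * k + 2 = m + k + 2 by ring, show m - k + 2 * k + j + 3 = m + k + j + 3 by ring,
    show m - (k + 1) - j = m - k - j - 1 by ring, show m - (k + 1) + 1 = m - k by ring,
    show m + (k + 1) + 1 = m + k + 2 by ring, show m + (k + 1) + j + 2 = m + k + j + 3 by ring,
    rfac_eq_mul (k := m - k - j - 1) (l := m - k - j) (by ring),
    rfac_eq_mul (k := m - k) (l := m - k + 1) (by ring),
    rfac_eq_mul (k := m + k + 1) (l := m + k + 2) (by ring),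
    rfac_eq_mul (k := m + k + j + 2) (l := m + k + j + 3) (by ring)]
  push_cast
  ring

theorem tailOddAbs_sub {m j k : ℤ} (hm : 0 ≤ m) :
    walkFormula (m - k) (2 * k + 1) j = tailOddAbs m j (k + 1) - tailOddAbs m j k := by
  unfold walkFormula tailOddAbs
  rw [show 2 * (m - k) + (2 * k + 1) = 2 * m + 1 by ring,
    zfac_eq_mul (k := 2 * m + 2) (l := 2 * m + 1 + 2) (by omega) (by ring),
    show m - k + (2 * k + 1) + 2 = m + k + 3 by ring,
    show m - k + (2 * k + 1) + j + 3 = m + k + j + 4 by ring,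
    show m - (k + 1) - j = m - k - j - 1 by ring, show m - (k + 1) + 1 = m - k by ring,
    show m + (k + 1) + 2 = m + k + 3 by ring, show m + (k + 1) + j + 3 = m + k + j + 4 by ring,
    rfac_eq_mul (k := m - k - j - 1) (l := m - k - j) (by ring),
    rfac_eq_mul (k := m - k) (l := m - k + 1) (by ring),
    rfac_eq_mul (k := m + k + 2) (l := m + k + 3) (by ring),
    rfac_eq_mul (k := m + k + j + 3) (l := m + k + j + 4) (by ring)]
  push_cast
  ring

theorem tailOrd_sub (m i j : ℤ) :
    walkFormula m i j = tailOrd m i (j + 1) - tailOrd m i j := by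
  unfold walkFormula tailOrd
  rw [show m - (j + 1) = m - j - 1 by ring, show m + i + (j + 1) + 2 = m + i + j + 3 by ring,
    rfac_eq_mul (k := m - j - 1) (l := m - j) (by ring),
    rfac_eq_mul (k := m + i + j + 2) (l := m + i + j + 3) (by ring)]
  push_cast
  ring

theorem tailAbsEven_sub {m k : ℤ} (hm : 0 ≤ m) :
    absFormula (m - k) (2 * k) = tailAbsEven m (k + 1) - tailAbsEven m k := by
  unfold absFormula tailAbsEven
  rw [show 2 * (m - k) + 2 * k = 2 * m by ring,
    zfac_eq_mul (k := 2 * m + 1) (l := 2 * m + 2) (by omega) (by ring),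
    show m - k + 2 * k + 1 = m + k + 1 by ring, show m - k + 2 * k + 2 = m + k + 2 by ring,
    show m - (k + 1) = m - k - 1 by ring, show m - k - 1 + 1 = m - k by ring,
    show m + (k + 1) = m + k + 1 by ring, show m + k + 1 + 1 = m + k + 2 by ring,
    rfac_eq_mul (k := m - k - 1) (l := m - k) (by ring),
    rfac_eq_mul (k := m - k) (l := m - k + 1) (by ring),
    rfac_eq_mul (k := m + k) (l := m + k + 1) (by ring),
    rfac_eq_mul (k := m + k + 1) (l := m + k + 2) (by ring)]
  push_cast
  ring

theorem tailAbsOdd_sub {m k : ℤ} (hm : 0 ≤ m) :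
    absFormula (m - k) (2 * k + 1) = tailAbsOdd m (k + 1) - tailAbsOdd m k := by
  unfold absFormula tailAbsOdd
  rw [show 2 * (m - k) + (2 * k + 1) = 2 * m + 1 by ring,
    zfac_eq_mul (k := 2 * m + 2) (l := 2 * m + 1 + 2) (by omega) (by ring),
    show m - k + (2 * k + 1) + 1 = m + k + 2 by ring,
    show m - k + (2 * k + 1) + 2 = m + k + 3 by ring,
    show m - (k + 1) = m - k - 1 by ring, show m - k - 1 + 1 = m - k by ring,
    show m + (k + 1) + 1 = m + k + 2 by ring, show m + (k + 1) + 2 = m + k + 3 by ring,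
    rfac_eq_mul (k := m - k - 1) (l := m - k) (by ring),
    rfac_eq_mul (k := m - k) (l := m - k + 1) (by ring),
    rfac_eq_mul (k := m + k + 1) (l := m + k + 2) (by ring),
    rfac_eq_mul (k := m + k + 2) (l := m + k + 3) (by ring)]
  push_cast
  ring

theorem tailOrdEven_sub (m j : ℤ) :
    ordEven m j = tailOrdEven m (j + 1) - tailOrdEven m j := by
  unfold ordEven tailOrdEven
  rw [show m - (j + 1) = m - j - 1 by ring, show m + (j + 1) + 1 = m + j + 2 by ring,
    rfac_eq_mul (k := m - j - 1) (l := m - j) (by ring),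
    rfac_eq_mul (k := m + j + 1) (l := m + j + 2) (by ring)]
  push_cast
  ring

theorem tailOrdOdd_sub (m j : ℤ) :
    ordOdd m j = tailOrdOdd m (j + 1) - tailOrdOdd m j := by
  unfold ordOdd tailOrdOdd
  rw [show m - (j + 1) = m - j - 1 by ring, show m + (j + 1) + 1 = m + j + 2 by ring,
    rfac_eq_mul (k := m - j - 1) (l := m - j) (by ring),
    rfac_eq_mul (k := m + j + 1) (l := m + j + 2) (by ring)]
  push_cast
  ring

theorem q_even (m j k : ℕ) :
    (q (2 * k) j (2 * m) : ℚ) = tailEvenAbs m j (k + 1 : ℕ) - tailEvenAbs m j k := by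
  rw [q_eq_walkFormula ((m : ℤ) - k) (by push_cast; ring)]
  push_cast
  exact tailEvenAbs_sub (by omega)

theorem q_odd (m j k : ℕ) :
    (q (2 * k + 1) j (2 * m + 1) : ℚ) = tailOddAbs m j (k + 1 : ℕ) - tailOddAbs m j k := by
  rw [q_eq_walkFormula ((m : ℤ) - k) (by push_cast; ring)]
  push_cast
  exact tailOddAbs_sub (by omega)

theorem q_ord (m i j : ℕ) :
    (q i j (2 * m + i) : ℚ) = tailOrd m i (j + 1 : ℕ) - tailOrd m i j := by
  rw [q_eq_walkFormula (m : ℤ) (by push_cast; ring)]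
  push_cast
  exact tailOrd_sub _ _ _

theorem sum_q_even (m j : ℕ) {a b : ℕ} (h : a ≤ b) :
    ∑ i ∈ Finset.Icc a b, (q i j (2 * m) : ℚ) =
      tailEvenAbs m j (b / 2 + 1 : ℕ) - tailEvenAbs m j ((a + 1) / 2 : ℕ) :=
  sum_Icc_even_eq_sub (g := fun k => tailEvenAbs m j k)
    (fun k => by rw [q_eq_zero_of_parity (by push_cast; omega), Nat.cast_zero]) (q_even m j) h

theorem sum_q_odd (m j : ℕ) {a b : ℕ} (h : a ≤ b) :
    ∑ i ∈ Finset.Icc a b, (q i j (2 * m + 1) : ℚ) =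
      tailOddAbs m j ((b + 1) / 2 : ℕ) - tailOddAbs m j (a / 2 : ℕ) :=
  sum_Icc_odd_eq_sub (g := fun k => tailOddAbs m j k)
    (fun k => by rw [q_eq_zero_of_parity (by push_cast; omega), Nat.cast_zero]) (q_odd m j) h

theorem sum_q_ord (m i : ℕ) {a b : ℕ} (h : a ≤ b) :
    ∑ j ∈ Finset.Icc a b, (q i j (2 * m + i) : ℚ) =
      tailOrd m i (b + 1 : ℕ) - tailOrd m i a :=
  sum_Icc_eq_sub (g := fun k => tailOrd m i k) (q_ord m i) h

theorem qOrd_even (j m : ℕ) : (qOrd j (2 * m) : ℚ) = ordEven m j := by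
  rw [qOrd_eq_sum, Finset.range_eq_Ico, Finset.Ico_add_one_right_eq_Icc, Nat.cast_sum,
    sum_q_even m j (Nat.zero_le _), show 2 * m / 2 + 1 = m + 1 by omega,
    show (0 + 1) / 2 = 0 by norm_num]
  unfold tailEvenAbs ordEven
  -- The upper boundary term vanishes, as it contains the reciprocal factorial of a negative number;
  -- the total is minus the tail at 0.
  rw [rfac_of_neg (k := (m : ℤ) - (m + 1 : ℕ) - j) (by push_cast; omega),
    zfac_eq_mul (k := 2 * (m : ℤ) + 1) (l := 2 * m + 2) (by omega) (by ring)]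
  push_cast
  simp only [sub_zero, add_zero]
  ring

theorem qOrd_odd (j m : ℕ) : (qOrd j (2 * m + 1) : ℚ) = ordOdd m j := by
  rw [qOrd_eq_sum, Finset.range_eq_Ico, Finset.Ico_add_one_right_eq_Icc, Nat.cast_sum,
    sum_q_odd m j (Nat.zero_le _), show (2 * m + 1 + 1) / 2 = m + 1 by omega,
    show 0 / 2 = 0 by norm_num]
  unfold tailOddAbs ordOdd
  rw [rfac_of_neg (k := (m : ℤ) - (m + 1 : ℕ) - j) (by push_cast; omega),
    rfac_eq_mul (k := (m : ℤ) + j + 2) (l := m + j + 3) (by ring)]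
  push_cast
  simp only [sub_zero, add_zero]
  ring

theorem qAbs_eq_absFormula (i m : ℕ) : (qAbs i (2 * m + i) : ℚ) = absFormula m i := by
  rw [qAbs_eq_sum, Finset.range_eq_Ico, Finset.Ico_add_one_right_eq_Icc, Nat.cast_sum,
    sum_q_ord m i (Nat.zero_le _)]
  unfold tailOrd absFormula
  rw [rfac_of_neg (k := (m : ℤ) - ((2 * m + i + 1 : ℕ) : ℤ)) (by push_cast; omega),
    rfac_eq_mul (k := (m : ℤ) + i + 1) (l := m + i + 2) (by ring)]
  push_cast
  simp only [sub_zero, add_zero]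
  ring

theorem qAbs_eq_zero_of_lt {i n : ℕ} (h : n < i) : qAbs i n = 0 := by
  rw [qAbs_eq_sum]
  exact Finset.sum_eq_zero fun j _ => q_eq_zero (Or.inl h)

theorem qAbs_eq_zero_of_parity {i n : ℕ} (h : ((n : ℤ) - i) % 2 = 1) : qAbs i n = 0 := by
  rw [qAbs_eq_sum]
  exact Finset.sum_eq_zero fun j _ => q_eq_zero_of_parity h

/-- Negative m means n < i, where both sides vanish. This case occurs below with m - k in place of m
and k > m. -/
theorem qAbs_eq_absFormula_int {i n : ℕ} (m : ℤ) (h : (n : ℤ) = 2 * m + i) :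
    (qAbs i n : ℚ) = absFormula m i := by
  rcases lt_or_ge m 0 with hm | hm
  · rw [qAbs_eq_zero_of_lt (by omega), absFormula, rfac_of_neg hm]
    simp
  · obtain ⟨m, rfl⟩ := Int.eq_ofNat_of_zero_le hm
    obtain rfl : n = 2 * m + i := by omega
    exact qAbs_eq_absFormula i m

theorem qAbs_even (m k : ℕ) :
    (qAbs (2 * k) (2 * m) : ℚ) = tailAbsEven m (k + 1 : ℕ) - tailAbsEven m k := by
  rw [qAbs_eq_absFormula_int ((m : ℤ) - k) (by push_cast; ring)]
  push_cast
  exact tailAbsEven_sub (by omega)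

theorem qAbs_odd (m k : ℕ) :
    (qAbs (2 * k + 1) (2 * m + 1) : ℚ) = tailAbsOdd m (k + 1 : ℕ) - tailAbsOdd m k := by
  rw [qAbs_eq_absFormula_int ((m : ℤ) - k) (by push_cast; ring)]
  push_cast
  exact tailAbsOdd_sub (by omega)

theorem sum_qAbs_even (m : ℕ) {a b : ℕ} (h : a ≤ b) :
    ∑ i ∈ Finset.Icc a b, (qAbs i (2 * m) : ℚ) =
      tailAbsEven m (b / 2 + 1 : ℕ) - tailAbsEven m ((a + 1) / 2 : ℕ) :=
  sum_Icc_even_eq_sub (g := fun k => tailAbsEven m k)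
    (fun k => by rw [qAbs_eq_zero_of_parity (by push_cast; omega), Nat.cast_zero]) (qAbs_even m) h

theorem sum_qAbs_odd (m : ℕ) {a b : ℕ} (h : a ≤ b) :
    ∑ i ∈ Finset.Icc a b, (qAbs i (2 * m + 1) : ℚ) =
      tailAbsOdd m ((b + 1) / 2 : ℕ) - tailAbsOdd m (a / 2 : ℕ) :=
  sum_Icc_odd_eq_sub (g := fun k => tailAbsOdd m k)
    (fun k => by rw [qAbs_eq_zero_of_parity (by push_cast; omega), Nat.cast_zero]) (qAbs_odd m) h

theorem qOrd_even_sub (m j : ℕ) :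
    (qOrd j (2 * m) : ℚ) = tailOrdEven m (j + 1 : ℕ) - tailOrdEven m j := by
  rw [qOrd_even]
  push_cast
  exact tailOrdEven_sub _ _

theorem qOrd_odd_sub (m j : ℕ) :
    (qOrd j (2 * m + 1) : ℚ) = tailOrdOdd m (j + 1 : ℕ) - tailOrdOdd m j := by
  rw [qOrd_odd]
  push_cast
  exact tailOrdOdd_sub _ _

theorem sum_qOrd_even (m : ℕ) {a b : ℕ} (h : a ≤ b) :
    ∑ j ∈ Finset.Icc a b, (qOrd j (2 * m) : ℚ) =
      tailOrdEven m (b + 1 : ℕ) - tailOrdEven m a :=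
  sum_Icc_eq_sub (g := fun k => tailOrdEven m k) (qOrd_even_sub m) h

theorem sum_qOrd_odd (m : ℕ) {a b : ℕ} (h : a ≤ b) :
    ∑ j ∈ Finset.Icc a b, (qOrd j (2 * m + 1) : ℚ) =
      tailOrdOdd m (b + 1 : ℕ) - tailOrdOdd m a :=
  sum_Icc_eq_sub (g := fun k => tailOrdOdd m k) (qOrd_odd_sub m) h

theorem qOrd_even_eq (j m : ℕ) : (qOrd j (2 * m) : ℚ) =
    if j ≤ m then ((j + 1) * (2 * m)! * (2 * m + 2)! : ℚ) /
      ((m - j)! * (m + 1)! ^ 2 * (m + j + 2)!) else 0 := by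
  rw [qOrd_even, ordEven]
  split_ifs with h
  · have h1 : (m : ℤ) - j = ((m - j : ℕ) : ℤ) := by omega
    have h2 : 2 * (m : ℤ) = ((2 * m : ℕ) : ℤ) := by push_cast; ring
    have h3 : 2 * (m : ℤ) + 2 = ((2 * m + 2 : ℕ) : ℤ) := by push_cast; ring
    have h4 : (m : ℤ) + 1 = ((m + 1 : ℕ) : ℤ) := by push_cast; ring
    have h5 : (m : ℤ) + j + 2 = ((m + j + 2 : ℕ) : ℤ) := by push_cast; ring
    rw [h1, h3, h2, h4, h5]
    simp only [rfac_natCast, zfac_natCast]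
    push_cast
    rw [div_eq_mul_inv, mul_inv, mul_inv]
    ring
  · rw [rfac_of_neg (by omega)]
    ring

theorem qOrd_odd_eq (j m : ℕ) : (qOrd j (2 * m + 1) : ℚ) =
    if j ≤ m then (2 * (j + 1) * (2 * m + 1)! * (2 * m + 2)! : ℚ) /
      ((m - j)! * (m + 1)! * (m + 2)! * (m + j + 2)!) else 0 := by
  rw [qOrd_odd, ordOdd]
  split_ifs with h
  · have h1 : (m : ℤ) - j = ((m - j : ℕ) : ℤ) := by omega
    have h2 : 2 * (m : ℤ) + 1 = ((2 * m + 1 : ℕ) : ℤ) := by push_cast; ring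
    have h3 : 2 * (m : ℤ) + 2 = ((2 * m + 2 : ℕ) : ℤ) := by push_cast; ring
    have h4 : (m : ℤ) + 1 = ((m + 1 : ℕ) : ℤ) := by push_cast; ring
    have h5 : (m : ℤ) + j + 2 = ((m + j + 2 : ℕ) : ℤ) := by push_cast; ring
    have h6 : (m : ℤ) + 2 = ((m + 2 : ℕ) : ℤ) := by push_cast; ring
    rw [h1, h3, h2, h4, h5, h6]
    simp only [rfac_natCast, zfac_natCast]
    push_cast
    rw [div_eq_mul_inv, mul_inv, mul_inv, mul_inv]
    ring
  · rw [rfac_of_neg (by omega)]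
    ring

theorem qAbs_eq (i m : ℕ) : (qAbs i (2 * m + i) : ℚ) =
    ((i + 1) * (2 * m + i)! * (2 * m + i + 2)! : ℚ) /
      (m ! * (m + 1)! * (m + i + 1)! * (m + i + 2)!) := by
  rw [qAbs_eq_absFormula, absFormula]
  have h2 : 2 * (m : ℤ) + i = ((2 * m + i : ℕ) : ℤ) := by push_cast; ring
  have h3 : 2 * (m : ℤ) + i + 2 = ((2 * m + i + 2 : ℕ) : ℤ) := by push_cast; ring
  have h4 : (m : ℤ) + 1 = ((m + 1 : ℕ) : ℤ) := by push_cast; ring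
  have h5 : (m : ℤ) + i + 1 = ((m + i + 1 : ℕ) : ℤ) := by push_cast; ring
  have h6 : (m : ℤ) + i + 2 = ((m + i + 2 : ℕ) : ℤ) := by push_cast; ring
  rw [h3, h2, h4, h5, h6]
  simp only [rfac_natCast, zfac_natCast]
  rw [div_eq_mul_inv, mul_inv, mul_inv, mul_inv]
  push_cast
  ring

theorem qAbs_zero_eq (m : ℕ) : (qAbs 0 (2 * m) : ℚ) =
    ((2 * m)! * (2 * m + 2)! : ℚ) / (m ! * (m + 1)! ^ 2 * (m + 2)!) := by
  have h := qAbs_eq 0 m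
  simp only [add_zero, Nat.cast_zero, zero_add, one_mul] at h
  rw [h]
  ring

theorem qOrd_zero_eq_qAbs_zero (m : ℕ) : qOrd 0 (2 * m) = qAbs 0 (2 * m) := by
  have h := qOrd_even_eq 0 m
  rw [if_pos (Nat.zero_le m)] at h
  have : (qOrd 0 (2 * m) : ℚ) = qAbs 0 (2 * m) := by
    rw [h, qAbs_zero_eq]
    simp
  exact_mod_cast this

theorem qTot_even_eq (m : ℕ) : (qTot (2 * m) : ℚ) =
    ((2 * m)! * (2 * m + 1)! : ℚ) / (m ! ^ 2 * (m + 1)! ^ 2) := by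
  rw [qTot_eq_sum_qOrd, Finset.range_eq_Ico, Finset.Ico_add_one_right_eq_Icc, Nat.cast_sum,
    sum_qOrd_even m (Nat.zero_le _)]
  unfold tailOrdEven
  have h2 : 2 * (m : ℤ) = ((2 * m : ℕ) : ℤ) := by push_cast; ring
  have h3 : 2 * (m : ℤ) + 1 = ((2 * m + 1 : ℕ) : ℤ) := by push_cast; ring
  rw [rfac_of_neg (k := (m : ℤ) - ((2 * m + 1 : ℕ) : ℤ)) (by push_cast; omega),
    zfac_eq_mul (k := 2 * (m : ℤ) + 1) (l := 2 * m + 2) (by omega) (by ring), Nat.cast_zero,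
    sub_zero, add_zero, rfac_eq_mul (k := m) (l := m + 1) (by ring), h3, h2,
    show (m : ℤ) + 1 = ((m + 1 : ℕ) : ℤ) by push_cast; ring]
  simp only [rfac_natCast, zfac_natCast]
  rw [Nat.factorial_succ m]
  push_cast
  field_simp
  ring

theorem qTot_odd_eq (m : ℕ) : (qTot (2 * m + 1) : ℚ) =
    ((2 * m + 1)! * (2 * m + 2)! : ℚ) / (m ! * (m + 1)! ^ 2 * (m + 2)!) := by
  rw [qTot_eq_sum_qOrd, Finset.range_eq_Ico, Finset.Ico_add_one_right_eq_Icc, Nat.cast_sum,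
    sum_qOrd_odd m (Nat.zero_le _)]
  unfold tailOrdOdd
  have h2 : 2 * (m : ℤ) + 2 = ((2 * m + 2 : ℕ) : ℤ) := by push_cast; ring
  have h3 : 2 * (m : ℤ) + 1 = ((2 * m + 1 : ℕ) : ℤ) := by push_cast; ring
  rw [rfac_of_neg (k := (m : ℤ) - ((2 * m + 1 + 1 : ℕ) : ℤ)) (by push_cast; omega),
    Nat.cast_zero, sub_zero, add_zero, h3, h2,
    show (m : ℤ) + 1 = ((m + 1 : ℕ) : ℤ) by push_cast; ring,
    show (m : ℤ) + 2 = ((m + 2 : ℕ) : ℤ) by push_cast; ring]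
  simp only [rfac_natCast, zfac_natCast]
  rw [div_eq_mul_inv, mul_inv, mul_inv]
  push_cast
  ring

end GouyouBeauchamps

/-! ### The counts and their antidifferences as hypergeometric terms -/

namespace GouyouBeauchamps

open MvPolynomial

/-- The data supplied are the polynomial factor, then the linear forms under the factorials of the
numerator and of the denominator, each given by its coefficients and its constant term. The same
pattern serves for all terms below. -/
theorem isHypergeometricTerm_q_even :
    IsHypergeometricTerm fun v : Fin 3 → ℕ => (q (2 * v 2) (v 1) (2 * v 0) : ℚ) := by
  refine isHypergeometricTerm_of_eq
    ((2 * X 2 + 1) * (X 1 + 1) * (2 * X 2 + X 1 + 2) * (2 * X 2 + 2 * X 1 + 3))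
    [(![2, 0, 0], 0), (![2, 0, 0], 2)]
    [(![1, -1, -1], 0), (![1, 0, -1], 1), (![1, 0, 1], 2), (![1, 1, 1], 3)]
    (by norm_num) (by simp [Fin.forall_fin_succ]) fun v => ?_
  rw [q_eq_walkFormula ((v 0 : ℤ) - v 2) (by push_cast; ring)]
  simp [linVal, Fin.sum_univ_three, walkFormula]
  ring_nf

theorem isHypergeometricTerm_q_odd :
    IsHypergeometricTerm fun v : Fin 3 → ℕ => (q (2 * v 2 + 1) (v 1) (2 * v 0 + 1) : ℚ) := by
  refine isHypergeometricTerm_of_eq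
    ((2 * X 2 + 2) * (X 1 + 1) * (2 * X 2 + X 1 + 3) * (2 * X 2 + 2 * X 1 + 4))
    [(![2, 0, 0], 1), (![2, 0, 0], 3)]
    [(![1, -1, -1], 0), (![1, 0, -1], 1), (![1, 0, 1], 3), (![1, 1, 1], 4)]
    (by norm_num) (by simp [Fin.forall_fin_succ]) fun v => ?_
  rw [q_eq_walkFormula ((v 0 : ℤ) - v 2) (by push_cast; ring)]
  simp [linVal, Fin.sum_univ_three, walkFormula]
  ring_nf

theorem isHypergeometricTerm_q_ord :
    IsHypergeometricTerm fun v : Fin 3 → ℕ => (q (v 1) (v 2) (2 * v 0 + v 1) : ℚ) := by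
  refine isHypergeometricTerm_of_eq
    ((X 1 + 1) * (X 2 + 1) * (X 1 + X 2 + 2) * (X 1 + 2 * X 2 + 3))
    [(![2, 1, 0], 0), (![2, 1, 0], 2)]
    [(![1, 0, -1], 0), (![1, 0, 0], 1), (![1, 1, 0], 2), (![1, 1, 1], 3)]
    (by norm_num) (by simp [Fin.forall_fin_succ]) fun v => ?_
  rw [q_eq_walkFormula (v 0 : ℤ) (by push_cast; ring)]
  simp [linVal, Fin.sum_univ_three, walkFormula]
  ring_nf

theorem isHypergeometricTerm_tailEvenAbs :
    IsHypergeometricTerm fun v : Fin 3 → ℕ => tailEvenAbs (v 0) (v 1) (v 2) := by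
  refine isHypergeometricTerm_of_eq
    (-2 * (X 1 + 1) * (X 0 + 1 + 2 * X 2 * (X 2 + X 1 + 1)))
    [(![2, 0, 0], 0), (![2, 0, 0], 1)]
    [(![1, -1, -1], 0), (![1, 0, -1], 1), (![1, 0, 1], 1), (![1, 1, 1], 2)]
    (by norm_num) (by simp [Fin.forall_fin_succ]) fun v => ?_
  simp [linVal, Fin.sum_univ_three, tailEvenAbs]
  ring_nf

theorem isHypergeometricTerm_tailOddAbs :
    IsHypergeometricTerm fun v : Fin 3 → ℕ => tailOddAbs (v 0) (v 1) (v 2) := by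
  refine isHypergeometricTerm_of_eq
    (-(X 1 + 1) * (4 * X 2 ^ 2 + 4 * (X 1 + 2) * X 2 + 2 * X 0 + 2 * X 1 + 6))
    [(![2, 0, 0], 1), (![2, 0, 0], 2)]
    [(![1, -1, -1], 0), (![1, 0, -1], 1), (![1, 0, 1], 2), (![1, 1, 1], 3)]
    (by norm_num) (by simp [Fin.forall_fin_succ]) fun v => ?_
  simp [linVal, Fin.sum_univ_three, tailOddAbs]
  ring_nf

theorem isHypergeometricTerm_tailOrd :
    IsHypergeometricTerm fun v : Fin 3 → ℕ => tailOrd (v 0) (v 1) (v 2) := by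
  refine isHypergeometricTerm_of_eq
    (-(X 1 + 1) * (X 2 ^ 2 + (X 1 + 2) * X 2 + X 0 + X 1 + 2))
    [(![2, 1, 0], 0), (![2, 1, 0], 2)]
    [(![1, 0, -1], 0), (![1, 0, 0], 1), (![1, 1, 0], 2), (![1, 1, 1], 2)]
    (by norm_num) (by simp [Fin.forall_fin_succ]) fun v => ?_
  simp [linVal, Fin.sum_univ_three, tailOrd]
  ring_nf

theorem isHypergeometricTerm_qAbs_even :
    IsHypergeometricTerm fun v : Fin 2 → ℕ => (qAbs (2 * v 1) (2 * v 0) : ℚ) := by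
  refine isHypergeometricTerm_of_eq (2 * X 1 + 1)
    [(![2, 0], 0), (![2, 0], 2)] [(![1, -1], 0), (![1, -1], 1), (![1, 1], 1), (![1, 1], 2)]
    (by norm_num) (by simp [Fin.forall_fin_succ]) fun v => ?_
  rw [qAbs_eq_absFormula_int ((v 0 : ℤ) - v 1) (by push_cast; ring)]
  simp [linVal, absFormula]
  ring_nf

theorem isHypergeometricTerm_qAbs_odd :
    IsHypergeometricTerm fun v : Fin 2 → ℕ => (qAbs (2 * v 1 + 1) (2 * v 0 + 1) : ℚ) := by
  refine isHypergeometricTerm_of_eq (2 * X 1 + 2)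
    [(![2, 0], 1), (![2, 0], 3)] [(![1, -1], 0), (![1, -1], 1), (![1, 1], 2), (![1, 1], 3)]
    (by norm_num) (by simp [Fin.forall_fin_succ]) fun v => ?_
  rw [qAbs_eq_absFormula_int ((v 0 : ℤ) - v 1) (by push_cast; ring)]
  simp [linVal, absFormula]
  ring_nf

theorem isHypergeometricTerm_qOrd_even :
    IsHypergeometricTerm fun v : Fin 2 → ℕ => (qOrd (v 1) (2 * v 0) : ℚ) := by
  refine isHypergeometricTerm_of_eq (X 1 + 1)
    [(![2, 0], 0), (![2, 0], 2)] [(![1, -1], 0), (![1, 0], 1), (![1, 0], 1), (![1, 1], 2)]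
    (by norm_num) (by simp [Fin.forall_fin_succ]) fun v => ?_
  rw [qOrd_even]
  simp [linVal, ordEven]
  ring_nf

theorem isHypergeometricTerm_qOrd_odd :
    IsHypergeometricTerm fun v : Fin 2 → ℕ => (qOrd (v 1) (2 * v 0 + 1) : ℚ) := by
  refine isHypergeometricTerm_of_eq (2 * (X 1 + 1))
    [(![2, 0], 1), (![2, 0], 2)] [(![1, -1], 0), (![1, 0], 1), (![1, 0], 2), (![1, 1], 2)]
    (by norm_num) (by simp [Fin.forall_fin_succ]) fun v => ?_
  rw [qOrd_odd]
  simp [linVal, ordOdd]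
  ring_nf

theorem isHypergeometricTerm_tailAbsEven :
    IsHypergeometricTerm fun v : Fin 2 → ℕ => tailAbsEven (v 0) (v 1) := by
  refine isHypergeometricTerm_of_eq (-1)
    [(![2, 0], 0), (![2, 0], 1)] [(![1, -1], 0), (![1, -1], 1), (![1, 1], 0), (![1, 1], 1)]
    (by norm_num) (by simp [Fin.forall_fin_succ]) fun v => ?_
  simp [linVal, tailAbsEven]
  ring_nf

theorem isHypergeometricTerm_tailAbsOdd :
    IsHypergeometricTerm fun v : Fin 2 → ℕ => tailAbsOdd (v 0) (v 1) := by
  refine isHypergeometricTerm_of_eq (-1)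
    [(![2, 0], 1), (![2, 0], 2)] [(![1, -1], 0), (![1, -1], 1), (![1, 1], 1), (![1, 1], 2)]
    (by norm_num) (by simp [Fin.forall_fin_succ]) fun v => ?_
  simp [linVal, tailAbsOdd]
  ring_nf

theorem isHypergeometricTerm_tailOrdEven :
    IsHypergeometricTerm fun v : Fin 2 → ℕ => tailOrdEven (v 0) (v 1) := by
  refine isHypergeometricTerm_of_eq (-C (1 / 2))
    [(![2, 0], 0), (![2, 0], 2)] [(![1, -1], 0), (![1, 0], 1), (![1, 0], 1), (![1, 1], 1)]
    (by norm_num) (by simp [Fin.forall_fin_succ]) fun v => ?_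
  simp [linVal, tailOrdEven]
  ring_nf

theorem isHypergeometricTerm_tailOrdOdd :
    IsHypergeometricTerm fun v : Fin 2 → ℕ => tailOrdOdd (v 0) (v 1) := by
  refine isHypergeometricTerm_of_eq (-1)
    [(![2, 0], 1), (![2, 0], 2)] [(![1, -1], 0), (![1, 0], 1), (![1, 0], 2), (![1, 1], 1)]
    (by norm_num) (by simp [Fin.forall_fin_succ]) fun v => ?_
  simp [linVal, tailOrdOdd]
  ring_nf

theorem gosperSummableIn_q_even :
    GosperSummableIn 2 fun v : Fin 3 → ℕ => (q (2 * v 2) (v 1) (2 * v 0) : ℚ) :=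
  ⟨isHypergeometricTerm_q_even 2, _, isHypergeometricTerm_tailEvenAbs 2, fun v => by
    simpa using q_even (v 0) (v 1) (v 2)⟩

theorem gosperSummableIn_q_odd :
    GosperSummableIn 2 fun v : Fin 3 → ℕ => (q (2 * v 2 + 1) (v 1) (2 * v 0 + 1) : ℚ) :=
  ⟨isHypergeometricTerm_q_odd 2, _, isHypergeometricTerm_tailOddAbs 2, fun v => by
    simpa using q_odd (v 0) (v 1) (v 2)⟩

theorem gosperSummableIn_q_ord :
    GosperSummableIn 2 fun v : Fin 3 → ℕ => (q (v 1) (v 2) (2 * v 0 + v 1) : ℚ) :=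
  ⟨isHypergeometricTerm_q_ord 2, _, isHypergeometricTerm_tailOrd 2, fun v => by
    simpa using q_ord (v 0) (v 1) (v 2)⟩

theorem gosperSummableIn_qAbs_even :
    GosperSummableIn 1 fun v : Fin 2 → ℕ => (qAbs (2 * v 1) (2 * v 0) : ℚ) :=
  ⟨isHypergeometricTerm_qAbs_even 1, _, isHypergeometricTerm_tailAbsEven 1, fun v => by
    simpa using qAbs_even (v 0) (v 1)⟩

theorem gosperSummableIn_qAbs_odd :
    GosperSummableIn 1 fun v : Fin 2 → ℕ => (qAbs (2 * v 1 + 1) (2 * v 0 + 1) : ℚ) :=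
  ⟨isHypergeometricTerm_qAbs_odd 1, _, isHypergeometricTerm_tailAbsOdd 1, fun v => by
    simpa using qAbs_odd (v 0) (v 1)⟩

theorem gosperSummableIn_qOrd_even :
    GosperSummableIn 1 fun v : Fin 2 → ℕ => (qOrd (v 1) (2 * v 0) : ℚ) :=
  ⟨isHypergeometricTerm_qOrd_even 1, _, isHypergeometricTerm_tailOrdEven 1, fun v => by
    simpa using qOrd_even_sub (v 0) (v 1)⟩

theorem gosperSummableIn_qOrd_odd :
    GosperSummableIn 1 fun v : Fin 2 → ℕ => (qOrd (v 1) (2 * v 0 + 1) : ℚ) :=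
  ⟨isHypergeometricTerm_qOrd_odd 1, _, isHypergeometricTerm_tailOrdOdd 1, fun v => by
    simpa using qOrd_odd_sub (v 0) (v 1)⟩

end GouyouBeauchamps

/-! ### Asymptotics from the Wallis product -/

namespace GouyouBeauchamps

open Filter Topology Real.Wallis

theorem tendsto_of_even_odd {α : Type*} {u : ℕ → α} {l : Filter α}
    (h0 : Tendsto (fun m => u (2 * m)) atTop l) (h1 : Tendsto (fun m => u (2 * m + 1)) atTop l) :
    Tendsto u atTop l := by
  intro s hs
  obtain ⟨a, ha⟩ := eventually_atTop.1 (h0 hs)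
  obtain ⟨b, hb⟩ := eventually_atTop.1 (h1 hs)
  refine eventually_atTop.2 ⟨2 * a + 2 * b + 1, fun n hn => ?_⟩
  rcases Nat.even_or_odd' n with ⟨m, rfl | rfl⟩
  · exact ha m (by omega)
  · exact hb m (by omega)

/-- This exact identity replaces Stirling's formula: the counts become 16^m / W(m) times a rational
function of m, and W(m) tends to π/2. -/
theorem factorial_two_mul_sq (m : ℕ) :
    ((2 * m)! : ℝ) ^ 2 = 16 ^ m * (m ! : ℝ) ^ 4 / (W m * (2 * m + 1)) := by
  rw [W_eq_factorial_ratio, pow_mul]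
  have h1 : ((2 * m)! : ℝ) ≠ 0 := by exact_mod_cast (Nat.factorial_pos _).ne'
  have h2 : (m ! : ℝ) ≠ 0 := by exact_mod_cast (Nat.factorial_pos _).ne'
  have h3 : (2 * m + 1 : ℝ) ≠ 0 := by positivity
  norm_num
  field_simp

theorem factorial_ne_zero_real (m : ℕ) : (m ! : ℝ) ≠ 0 := by
  exact_mod_cast (Nat.factorial_pos _).ne'

theorem qTot_even_real (m : ℕ) :
    (qTot (2 * m) : ℝ) = 16 ^ m / (W m * (m + 1) ^ 2) := by
  have h : (qTot (2 * m) : ℝ) = ((2 * m)! * (2 * m + 1)! : ℝ) / (m ! ^ 2 * (m + 1)! ^ 2) := by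
    simpa using congrArg (Rat.cast (K := ℝ)) (qTot_even_eq m)
  have hW := (W_pos m).ne'
  have hm := factorial_ne_zero_real m
  rw [h, Nat.factorial_succ (2 * m), Nat.factorial_succ m]
  push_cast
  rw [show ((2 * m)! : ℝ) * ((2 * m + 1) * (2 * m)!) = (2 * m)! ^ 2 * (2 * m + 1) by ring,
    factorial_two_mul_sq]
  have h3 : (2 * m + 1 : ℝ) ≠ 0 := by positivity
  field_simp

theorem qTot_odd_real (m : ℕ) :
    (qTot (2 * m + 1) : ℝ) = 16 ^ m * (2 * (2 * m + 1)) / (W m * ((m + 1) ^ 2 * (m + 2))) := by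
  have h : (qTot (2 * m + 1) : ℝ) =
      ((2 * m + 1)! * (2 * m + 2)! : ℝ) / (m ! * (m + 1)! ^ 2 * (m + 2)!) := by
    simpa using congrArg (Rat.cast (K := ℝ)) (qTot_odd_eq m)
  have hW := (W_pos m).ne'
  have hm := factorial_ne_zero_real m
  rw [h, Nat.factorial_succ (2 * m + 1), Nat.factorial_succ (2 * m), Nat.factorial_succ (m + 1),
    Nat.factorial_succ m]
  push_cast
  rw [show ((2 * m + 1) * (2 * m)! : ℝ) * ((2 * m + 1 + 1) * ((2 * m + 1) * (2 * m)!)) =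
    (2 * m)! ^ 2 * ((2 * m + 1) ^ 2 * (2 * m + 2)) by ring, factorial_two_mul_sq]
  have h3 : (2 * m + 1 : ℝ) ≠ 0 := by positivity
  have h4 : (m + 2 : ℝ) ≠ 0 := by positivity
  rw [show (m : ℝ) + 1 + 1 = m + 2 by ring]
  field_simp

theorem qAbs_zero_real (m : ℕ) :
    (qAbs 0 (2 * m) : ℝ) = 16 ^ m * 2 / (W m * ((m + 1) ^ 2 * (m + 2))) := by
  have h : (qAbs 0 (2 * m) : ℝ) =
      ((2 * m)! * (2 * m + 2)! : ℝ) / (m ! * (m + 1)! ^ 2 * (m + 2)!) := by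
    simpa using congrArg (Rat.cast (K := ℝ)) (qAbs_zero_eq m)
  have hW := (W_pos m).ne'
  have hm := factorial_ne_zero_real m
  rw [h, Nat.factorial_succ (2 * m + 1), Nat.factorial_succ (2 * m), Nat.factorial_succ (m + 1),
    Nat.factorial_succ m]
  push_cast
  rw [show ((2 * m)! : ℝ) * ((2 * m + 1 + 1) * ((2 * m + 1) * (2 * m)!)) =
    (2 * m)! ^ 2 * ((2 * m + 1) * (2 * m + 2)) by ring, factorial_two_mul_sq]
  have h3 : (2 * m + 1 : ℝ) ≠ 0 := by positivity
  have h4 : (m + 2 : ℝ) ≠ 0 := by positivity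
  rw [show (m : ℝ) + 1 + 1 = m + 2 by ring]
  field_simp

theorem qOrd_zero_odd_real (m : ℕ) :
    (qOrd 0 (2 * m + 1) : ℝ) =
      16 ^ m * (4 * (2 * m + 1)) / (W m * ((m + 1) ^ 2 * (m + 2) ^ 2)) := by
  have h' := qOrd_odd_eq 0 m
  rw [if_pos (Nat.zero_le m)] at h'
  have h : (qOrd 0 (2 * m + 1) : ℝ) =
      (2 * (0 + 1) * (2 * m + 1)! * (2 * m + 2)! : ℝ) /
        ((m - 0)! * (m + 1)! * (m + 2)! * (m + 0 + 2)!) := by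
    simpa using congrArg (Rat.cast (K := ℝ)) h'
  have hW := (W_pos m).ne'
  have hm := factorial_ne_zero_real m
  rw [h, Nat.sub_zero, Nat.add_zero, Nat.factorial_succ (2 * m + 1), Nat.factorial_succ (2 * m),
    Nat.factorial_succ (m + 1), Nat.factorial_succ m]
  push_cast
  rw [show 2 * (0 + 1) * ((2 * m + 1) * (2 * m)! : ℝ) *
    ((2 * m + 1 + 1) * ((2 * m + 1) * (2 * m)!)) =
    (2 * m)! ^ 2 * (2 * (2 * m + 1) ^ 2 * (2 * m + 2)) by ring, factorial_two_mul_sq]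
  have h3 : (2 * m + 1 : ℝ) ≠ 0 := by positivity
  have h4 : (m + 2 : ℝ) ≠ 0 := by positivity
  rw [show (m : ℝ) + 1 + 1 = m + 2 by ring]
  field_simp
  ring

theorem tendsto_natCast_div_add (a : ℝ) :
    Tendsto (fun m : ℕ => (m : ℝ) / (m + a)) atTop (𝓝 1) := tendsto_natCast_div_add_atTop a

theorem tendsto_two_mul_add_one_div (a : ℝ) :
    Tendsto (fun m : ℕ => (2 * m + 1 : ℝ) / (2 * (m + a))) atTop (𝓝 1) := by
  have h1 : Tendsto (fun m : ℕ => (m : ℝ) + a) atTop atTop :=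
    tendsto_atTop_add_const_right _ _ tendsto_natCast_atTop_atTop
  have h2 : Tendsto (fun m : ℕ => (m : ℝ) / (m + a) + 1 / 2 * ((m : ℝ) + a)⁻¹) atTop
      (𝓝 (1 + 1 / 2 * 0)) :=
    (tendsto_natCast_div_add a).add (h1.inv_tendsto_atTop.const_mul _)
  rw [mul_zero, add_zero] at h2
  refine h2.congr' ?_
  filter_upwards [h1.eventually_gt_atTop 0] with m hm
  field_simp

theorem tendsto_pi_div_W : Tendsto (fun m => Real.pi / 2 / W m) atTop (𝓝 1) := by
  have h := tendsto_W_nhds_pi_div_two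
  have hp : Real.pi / 2 ≠ 0 := by positivity
  have := (tendsto_const_nhds (x := Real.pi / 2)).div h hp
  rwa [div_self hp] at this

/-- The count behaves like (2/π) 16^m / m², and n = 2m turns the constant into 8/π. -/
theorem tendsto_qTot_even : Tendsto (fun m : ℕ => (qTot (2 * m) : ℝ) /
    (8 / Real.pi * (4 ^ (2 * m) / ((2 * m : ℕ) : ℝ) ^ 2))) atTop (𝓝 1) := by
  have h := tendsto_pi_div_W.mul ((tendsto_natCast_div_add 1).pow 2)
  rw [one_pow, one_mul] at h
  refine h.congr' ?_
  filter_upwards [eventually_gt_atTop 0] with m hm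
  have hm' : (m : ℝ) ≠ 0 := by positivity
  have hW := (W_pos m).ne'
  rw [qTot_even_real, pow_mul]
  push_cast
  norm_num
  field_simp
  ring

theorem tendsto_qTot_odd : Tendsto (fun m : ℕ => (qTot (2 * m + 1) : ℝ) /
    (8 / Real.pi * (4 ^ (2 * m + 1) / ((2 * m + 1 : ℕ) : ℝ) ^ 2))) atTop (𝓝 1) := by
  have h := tendsto_pi_div_W.mul (((tendsto_two_mul_add_one_div 1).pow 2).mul
    (tendsto_two_mul_add_one_div 2))
  rw [one_pow, one_mul, one_mul] at h
  refine h.congr' ?_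
  filter_upwards with m
  have hm' : (2 * m + 1 : ℝ) ≠ 0 := by positivity
  have hm2 : (m + 2 : ℝ) ≠ 0 := by positivity
  have hW := (W_pos m).ne'
  rw [qTot_odd_real, pow_succ (4 : ℝ), pow_mul]
  push_cast
  norm_num
  field_simp
  ring

/-- The count behaves like (4/π) 16^m / m³, and n = 2m turns the constant into 32/π. -/
theorem tendsto_qAbs_zero : Tendsto (fun m : ℕ => (qAbs 0 (2 * m) : ℝ) /
    (32 / Real.pi * (4 ^ (2 * m) / ((2 * m : ℕ) : ℝ) ^ 3))) atTop (𝓝 1) := by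
  have h := tendsto_pi_div_W.mul (((tendsto_natCast_div_add 1).pow 2).mul
    (tendsto_natCast_div_add 2))
  rw [one_pow, one_mul, one_mul] at h
  refine h.congr' ?_
  filter_upwards [eventually_gt_atTop 0] with m hm
  have hm' : (m : ℝ) ≠ 0 := by positivity
  have hm2 : (m + 2 : ℝ) ≠ 0 := by positivity
  have hW := (W_pos m).ne'
  rw [qAbs_zero_real, pow_mul]
  push_cast
  norm_num
  field_simp
  ring

theorem tendsto_qOrd_zero_odd : Tendsto (fun m : ℕ => (qOrd 0 (2 * m + 1) : ℝ) /
    (32 / Real.pi * (4 ^ (2 * m + 1) / ((2 * m + 1 : ℕ) : ℝ) ^ 3))) atTop (𝓝 1) := by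
  have h := tendsto_pi_div_W.mul (((tendsto_two_mul_add_one_div 1).pow 2).mul
    ((tendsto_two_mul_add_one_div 2).pow 2))
  rw [one_pow, one_mul, one_mul] at h
  refine h.congr' ?_
  filter_upwards with m
  have hm' : (2 * m + 1 : ℝ) ≠ 0 := by positivity
  have hm2 : (m + 2 : ℝ) ≠ 0 := by positivity
  have hW := (W_pos m).ne'
  rw [qOrd_zero_odd_real, pow_succ (4 : ℝ), pow_mul]
  push_cast
  norm_num
  field_simp
  ring

theorem qTot_isEquivalent : Asymptotics.IsEquivalent atTop
    (fun n : ℕ => (qTot n : ℝ)) (fun n : ℕ => 8 / Real.pi * (4 ^ n / (n : ℝ) ^ 2)) :=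
  Asymptotics.isEquivalent_of_tendsto_one (tendsto_of_even_odd tendsto_qTot_even tendsto_qTot_odd)

theorem qAbs_zero_isEquivalent : Asymptotics.IsEquivalent atTop
    (fun m : ℕ => (qAbs 0 (2 * m) : ℝ))
    (fun m : ℕ => 32 / Real.pi * (4 ^ (2 * m) / ((2 * m : ℕ) : ℝ) ^ 3)) :=
  Asymptotics.isEquivalent_of_tendsto_one tendsto_qAbs_zero

theorem qOrd_zero_isEquivalent : Asymptotics.IsEquivalent atTop
    (fun n : ℕ => (qOrd 0 n : ℝ)) (fun n : ℕ => 32 / Real.pi * (4 ^ n / (n : ℝ) ^ 3)) := by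
  refine Asymptotics.isEquivalent_of_tendsto_one (tendsto_of_even_odd ?_ tendsto_qOrd_zero_odd)
  simp only [Pi.div_apply, qOrd_zero_eq_qAbs_zero]
  exact tendsto_qAbs_zero

end GouyouBeauchamps

/-! ### Squared central binomials modulo a prime -/

namespace GouyouBeauchamps

open Polynomial

/-- `binom(n, n/2)²` for even `n`, and `0` for odd `n`. -/
def sqBinom (n : ℕ) : ℕ := if Even n then (n / 2).centralBinom ^ 2 else 0

theorem sqBinom_two_mul (m : ℕ) : sqBinom (2 * m) = m.centralBinom ^ 2 := by
  simp [sqBinom]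

theorem sqBinom_of_odd {n : ℕ} (h : ¬ Even n) : sqBinom n = 0 := by
  simp [sqBinom, h]

/-- This is the square of (m+1) binom(2m+2,m+1) = 2(2m+1) binom(2m,m). It encodes the differential
equation of the series. -/
theorem sqBinom_recurrence (n : ℕ) :
    (n + 2) ^ 2 * sqBinom (n + 2) = 16 * (n + 1) ^ 2 * sqBinom n := by
  rcases Nat.even_or_odd' n with ⟨m, rfl | rfl⟩
  · rw [show 2 * m + 2 = 2 * (m + 1) by ring, sqBinom_two_mul, sqBinom_two_mul]
    have h := Nat.succ_mul_centralBinom_succ m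
    calc (2 * (m + 1)) ^ 2 * (m + 1).centralBinom ^ 2
        = 4 * ((m + 1) * (m + 1).centralBinom) ^ 2 := by ring
      _ = _ := by rw [h]; ring
  · rw [sqBinom_of_odd (by simp [parity_simps]), sqBinom_of_odd (by simp [parity_simps])]
    ring

/-- Lucas's theorem for the digits r and s. As p is odd, p s + r has the parity of r + s, so the
congruence is trivial unless r and s have equal parity. -/
theorem sqBinom_modEq {p : ℕ} (hp : p.Prime) (h2 : p ≠ 2) {r : ℕ} (hr : r < p) (s : ℕ) :
    sqBinom (p * s + r) ≡ sqBinom r * sqBinom s [MOD p] := by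
  have : Fact p.Prime := ⟨hp⟩
  obtain ⟨l, hl⟩ := hp.odd_of_ne_two h2
  have hpp := hp.pos
  by_cases hn : Even (p * s + r)
  · rcases Nat.even_or_odd' r with ⟨ρ, rfl | rfl⟩ <;> rcases Nat.even_or_odd' s with ⟨σ, rfl | rfl⟩
    · rw [show p * (2 * σ) + 2 * ρ = 2 * (p * σ + ρ) by ring]
      simp only [sqBinom_two_mul, ← mul_pow]
      refine Nat.ModEq.pow 2 ?_
      rw [Nat.centralBinom]
      refine (Choose.choose_modEq_choose_mod_mul_choose_div_nat (p := p)).trans ?_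
      rw [show 2 * (p * σ + ρ) = 2 * ρ + p * (2 * σ) by ring, add_comm (p * σ),
        Nat.add_mul_mod_self_left, Nat.add_mul_mod_self_left, Nat.add_mul_div_left _ _ hpp,
        Nat.add_mul_div_left _ _ hpp, Nat.mod_eq_of_lt hr, Nat.mod_eq_of_lt (by omega : ρ < p),
        Nat.div_eq_of_lt hr, Nat.div_eq_of_lt (by omega : ρ < p), zero_add, zero_add]
      rfl
    · exfalso
      simp [parity_simps, hl] at hn
    · exfalso
      simp [parity_simps, hl] at hn
    -- Both digits odd: the right side is 0. With p = 2l+1, the lowest-digit factor in Lucas's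
    -- theorem is binom(2ρ+1, l+ρ+1), which vanishes because ρ < l.
    · rw [sqBinom_of_odd (n := 2 * ρ + 1) (by simp [parity_simps]), zero_mul,
        show p * (2 * σ + 1) + (2 * ρ + 1) = 2 * (p * σ + (l + ρ + 1)) by rw [hl]; ring,
        sqBinom_two_mul, Nat.modEq_zero_iff_dvd, Nat.centralBinom]
      refine dvd_pow ?_ two_ne_zero
      rw [← Nat.modEq_zero_iff_dvd]
      refine (Choose.choose_modEq_choose_mod_mul_choose_div_nat (p := p)).trans ?_
      rw [show 2 * (p * σ + (l + ρ + 1)) = 2 * ρ + 1 + p * (2 * σ + 1) by rw [hl]; ring,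
        add_comm (p * σ), Nat.add_mul_mod_self_left, Nat.add_mul_mod_self_left,
        Nat.mod_eq_of_lt hr, Nat.mod_eq_of_lt (by omega : l + ρ + 1 < p),
        Nat.choose_eq_zero_of_lt (by omega : 2 * ρ + 1 < l + ρ + 1), zero_mul]
  · rw [sqBinom_of_odd hn]
    have : sqBinom r * sqBinom s = 0 := by
      by_contra h
      rw [mul_eq_zero, not_or] at h
      have h1 : Even r := by
        by_contra h'
        exact h.1 (sqBinom_of_odd h')
      have h2 : Even s := by
        by_contra h'
        exact h.2 (sqBinom_of_odd h')
      exact hn ((h2.mul_left p).add h1)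
    rw [this]

variable (k : Type*) [Field k] (p : ℕ) [Fact p.Prime] [CharP k p]

/-- The series `∑ binom(2m,m)² X^(2m)`. -/
noncomputable def sqBinomSeries (R : Type*) [CommRing R] : PowerSeries R :=
  PowerSeries.mk fun n => (sqBinom n : R)

/-- In the Cauchy product only the pair (n mod p, p⌊n/p⌋) contributes to degree n, and its term is
given by the Lucas congruence. -/
theorem sqBinomSeries_eq_trunc_mul_expand (h2 : p ≠ 2) :
    sqBinomSeries k = (PowerSeries.trunc p (sqBinomSeries k) : PowerSeries k) *
      (sqBinomSeries k).expand p (Fact.out : p.Prime).ne_zero := by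
  have hp : p.Prime := Fact.out
  ext n
  rw [PowerSeries.coeff_mul, Finset.sum_eq_single (n % p, p * (n / p))]
  · rw [Polynomial.coeff_coe, PowerSeries.coeff_trunc, if_pos (Nat.mod_lt _ hp.pos),
      PowerSeries.coeff_expand_mul]
    simp only [sqBinomSeries, PowerSeries.coeff_mk]
    rw [← Nat.cast_mul]
    conv_lhs => rw [← Nat.div_add_mod n p]
    exact (CharP.natCast_eq_natCast' k p (sqBinom_modEq hp h2 (Nat.mod_lt _ hp.pos) _))
  · rintro ⟨a, b⟩ hab hne
    rw [Finset.HasAntidiagonal.mem_antidiagonal] at hab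
    simp only at hab ⊢
    rw [Polynomial.coeff_coe, PowerSeries.coeff_trunc]
    split_ifs with ha
    · rw [PowerSeries.coeff_expand_of_not_dvd, mul_zero]
      rintro ⟨c, rfl⟩
      apply hne
      rw [← hab, Nat.add_mul_mod_self_left, Nat.mod_eq_of_lt ha, Nat.add_mul_div_left _ _ hp.pos,
        Nat.div_eq_of_lt ha, zero_add]
    · rw [zero_mul]
  · intro h
    exact absurd (Finset.HasAntidiagonal.mem_antidiagonal.2 (Nat.mod_add_div n p)) h

/-- The coefficients come from the prime field, hence are fixed by Frobenius. -/
theorem expand_sqBinomSeries :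
    (sqBinomSeries k).expand p (Fact.out : p.Prime).ne_zero = sqBinomSeries k ^ p := by
  have : ExpChar k p := ExpChar.prime Fact.out
  have h := MvPowerSeries.map_frobenius_expand (R := k) p (Fact.out : p.Prime).ne_zero
    (f := (sqBinomSeries k : MvPowerSeries Unit k))
  rw [← h]
  change _ = PowerSeries.map (frobenius k p) ((sqBinomSeries k).expand p _)
  rw [PowerSeries.map_expand]
  congr 1
  ext n
  simp [sqBinomSeries]

theorem trunc_sqBinomSeries_mul_pow (h2 : p ≠ 2) :
    (PowerSeries.trunc p (sqBinomSeries k) : PowerSeries k) * sqBinomSeries k ^ (p - 1) = 1 := by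
  have hp : p.Prime := Fact.out
  have h := sqBinomSeries_eq_trunc_mul_expand k p h2
  rw [expand_sqBinomSeries] at h
  have h0 : sqBinomSeries k ≠ 0 := by
    intro h0
    have := congrArg (PowerSeries.coeff 0) h0
    simp [sqBinomSeries, sqBinom] at this
  have h1 : sqBinomSeries k ^ p = sqBinomSeries k ^ (p - 1) * sqBinomSeries k := by
    rw [← pow_succ, Nat.sub_add_cancel hp.one_le]
  rw [h1, ← mul_assoc] at h
  exact (mul_right_cancel₀ h0 (by rw [one_mul]; exact h)).symm

/-- The full series satisfies this equation by `sqBinom_recurrence`. Modulo p, cutting at degree p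
creates no error term. -/
theorem derivative_trunc_sqBinomSeries (h2 : p ≠ 2) :
    derivative ((X - 16 * X ^ 3) * derivative (PowerSeries.trunc p (sqBinomSeries k))) =
      16 * X * PowerSeries.trunc p (sqBinomSeries k) := by
  have hp : p.Prime := Fact.out
  have hp0 : ((p : ℕ) : k) = 0 := CharP.cast_eq_zero k p
  set T := PowerSeries.trunc p (sqBinomSeries k) with hT
  have hc : ∀ n, T.coeff n = if n < p then (sqBinom n : k) else 0 := fun n => by
    rw [hT, PowerSeries.coeff_trunc]
    simp [sqBinomSeries]
  rw [show (X - 16 * X ^ 3) * derivative T = X * derivative T - C 16 * (X ^ 3 * derivative T) by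
    rw [map_ofNat]; ring, show 16 * X * T = C 16 * (X * T) by rw [map_ofNat]; ring]
  ext n
  rw [coeff_derivative, coeff_sub, coeff_C_mul, coeff_C_mul, coeff_X_mul, coeff_derivative]
  rcases n with _ | n
  · rw [show (0 + 1 : ℕ) = 1 from rfl, coeff_X_pow_mul', if_neg (by norm_num), coeff_X_mul_zero, hc,
      sqBinom_of_odd (by decide)]
    simp
  · rw [coeff_X_mul]
    have h3 : (X ^ 3 * derivative T).coeff (n + 1 + 1) = n * T.coeff n := by
      rcases n with _ | n
      · rw [coeff_X_pow_mul', if_neg (by norm_num)]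
        simp
      · rw [show n + 1 + 1 + 1 = n + 3 from rfl, coeff_X_pow_mul, coeff_derivative]
        push_cast
        ring
    have key : ((n : k) + 2) ^ 2 * T.coeff (n + 2) = 16 * (n + 1) ^ 2 * T.coeff n := by
      rw [hc, hc]
      by_cases h : n + 2 < p
      · rw [if_pos h, if_pos (by omega)]
        exact_mod_cast congrArg (Nat.cast (R := k)) (sqBinom_recurrence n)
      rw [if_neg h, mul_zero]
      split_ifs with h'
      -- Only these two indices straddle the cut. In the first n is odd, so its coefficient is 0; in
      -- the second the factor (n+1)² is 0 in characteristic p.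
      · rcases (by omega : n + 2 = p ∨ n + 1 = p) with e | e
        · have : ¬ Even n := by
            intro hn
            have h4 := hp.eq_two_or_odd'
            have h5 : Even p := by
              rw [← e]
              exact hn.add even_two
            rcases h4 with h4 | h4
            · exact h2 h4
            · exact (Nat.not_even_iff_odd.2 h4) h5
          rw [sqBinom_of_odd this]
          simp
        · have : (n : k) + 1 = 0 := by
            rw [← hp0, ← e]
            push_cast
            ring
          rw [this]
          ring
      · rw [mul_zero]
    rw [h3]
    push_cast
    linear_combination key

end GouyouBeauchamps

/-! ### Simple roots, the Eisenstein criterion and transcendence of K -/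

namespace GouyouBeauchamps

open Polynomial

/-- An indicial argument: a solution vanishes to order 0 or 1 where D ≠ 0, and only to order 0 at a
simple zero of D. In characteristic p this holds for orders below p, which the degree bound
guarantees. -/
theorem derivative_ne_zero_of_ode {k : Type*} [Field k] {p : ℕ} [CharP k p] {T D G : k[X]}
    (hode : derivative (D * derivative T) = G * T) (hT : T ≠ 0) (hdeg : T.natDegree < p)
    {α : k} (hα : T.eval α = 0) (hD : D.eval α = 0 → (derivative D).eval α ≠ 0) :
    (derivative T).eval α ≠ 0 := by
  intro hder
  obtain ⟨U, hU, hU'⟩ := exists_eq_pow_rootMultiplicity_mul_and_not_dvd T hT α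
  set n := rootMultiplicity α T with hn
  have hn1 : 1 ≤ n := (rootMultiplicity_pos hT).2 hα
  have hUα : U.eval α ≠ 0 := fun h => hU' (dvd_iff_isRoot.2 h)
  have hnp : n < p := by
    have h := natDegree_le_of_dvd (pow_rootMultiplicity_dvd T α) hT
    rw [natDegree_pow, natDegree_X_sub_C, mul_one] at h
    exact h.trans_lt hdeg
  have hcast : ∀ l, 0 < l → l < p → (l : k) ≠ 0 := fun l h0 hl h =>
    absurd (Nat.le_of_dvd h0 ((CharP.cast_eq_zero_iff k p l).1 h)) (by omega)
  clear_value n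
  obtain ⟨j, rfl | rfl⟩ : ∃ j, n = 1 ∨ n = j + 2 := ⟨n - 2, by omega⟩
  · rw [hU] at hder
    simp [derivative_mul] at hder
    exact hUα hder
  set V : k[X] := C ((j : k) + 2) * U + (X - C α) * derivative U with hV
  have hVα : V.eval α ≠ 0 := by
    simp only [hV, eval_add, eval_mul, eval_C, eval_sub, eval_X, sub_self, zero_mul, add_zero]
    exact mul_ne_zero (by exact_mod_cast hcast (j + 2) (by omega) hnp) hUα
  have hT' : derivative T = (X - C α) ^ (j + 1) * V := by
    rw [hU, hV]
    simp only [derivative_mul, derivative_X_sub_C_pow, map_add, map_natCast, map_ofNat]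
    push_cast
    ring
  -- The differential equation divided by (X - α)^j. Its value at α forces D(α) = 0; its derivative
  -- at α then forces D'(α) = 0.
  have h1 : C ((j : k) + 1) * (D * V) + (X - C α) * derivative (D * V) =
      G * (X - C α) ^ 2 * U := by
    refine mul_left_cancel₀ (pow_ne_zero j (X_sub_C_ne_zero α)) ?_
    have h : derivative ((X - C α) ^ (j + 1) * (D * V)) = G * ((X - C α) ^ (j + 2) * U) := by
      rw [← hU, ← hode, hT']
      congr 1
      ring
    rw [derivative_mul, derivative_X_sub_C_pow, Nat.add_sub_cancel] at h
    push_cast at h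
    linear_combination h
  have h2 := congrArg (eval α) h1
  have h3 := congrArg (fun R => eval α (derivative R)) h1
  simp [derivative_mul, derivative_pow] at h2 h3
  have hj1 : ((j : k) + 1) ≠ 0 := by exact_mod_cast hcast (j + 1) (by omega) (by omega)
  have hD0 : D.eval α = 0 := by
    rcases h2 with h2 | h2 | h2
    · exact absurd h2 hj1
    · exact h2
    · exact absurd h2 hVα
  have hj2 : ((j : k) + 2) ≠ 0 := by exact_mod_cast hcast (j + 2) (by omega) hnp
  rw [hD0] at h3
  have h4 : ((j : k) + 2) * ((derivative D).eval α * V.eval α) = 0 := by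
    linear_combination h3
  exact mul_ne_zero hj2 (mul_ne_zero (hD hD0) hVα) h4

/-- A simple root α of T makes Y^N - T Eisenstein at X - α, hence irreducible. As k[X] is integrally
closed, it is the minimal polynomial of y up to a unit and divides every polynomial that annihilates
y. -/
theorem le_natDegree_of_aeval_eq_zero {k : Type*} [Field k] {T : k[X]} {α : k}
    (h0 : T.eval α = 0) (h1 : (derivative T).eval α ≠ 0) {N : ℕ} (hN : 0 < N) {y : PowerSeries k}
    (hy : y ^ N = T) {S : k[X][X]} (hS : S ≠ 0) (hSy : aeval y S = 0) : N ≤ S.natDegree := by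
  have hinj : FaithfulSMul k[X] (PowerSeries k) := by
    rw [faithfulSMul_iff_algebraMap_injective]
    intro a b hab
    simpa [PowerSeries.algebraMap_apply'] using hab
  have : Module.IsTorsionFree k[X] (PowerSeries k) :=
    Module.IsTorsionFree.trans_faithfulSMul k[X] (PowerSeries k) (PowerSeries k)
  set E : k[X][X] := X ^ N - C T with hE
  have hmonic : E.Monic := monic_X_pow_sub_C T hN.ne'
  have hdeg : E.natDegree = N := natDegree_X_pow_sub_C
  have hprime : (Ideal.span {X - C α} : Ideal k[X]).IsPrime :=
    (Ideal.span_singleton_prime (X_sub_C_ne_zero α)).2 (prime_X_sub_C α)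
  have heis : E.IsEisensteinAt (Ideal.span {X - C α}) := by
    refine hmonic.isEisensteinAt_of_mem_of_notMem hprime.ne_top (fun {n} hn => ?_) ?_
    · rw [hdeg] at hn
      rw [hE, coeff_sub, coeff_X_pow, if_neg hn.ne, zero_sub, coeff_C]
      split_ifs
      · exact neg_mem (Ideal.mem_span_singleton.2 (dvd_iff_isRoot.2 h0))
      · simp
    · rw [hE, coeff_sub, coeff_X_pow, if_neg hN.ne, zero_sub, coeff_C_zero, neg_mem_iff,
        Ideal.span_singleton_pow, Ideal.mem_span_singleton]
      rintro ⟨V, rfl⟩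
      apply h1
      simp [derivative_mul, derivative_pow]
  have hirr : Irreducible E := heis.irreducible hprime hmonic.isPrimitive (by rw [hdeg]; exact hN)
  have hroot : aeval y E = 0 := by
    rw [hE, map_sub, map_pow, aeval_X, aeval_C, hy]
    exact sub_self _
  have hint : IsIntegral k[X] y := ⟨E, hmonic, hroot⟩
  have hdvd := minpoly.isIntegrallyClosed_dvd hint hroot
  have hassoc : Associated (minpoly k[X] y) E :=
    (hirr.dvd_iff.1 hdvd).resolve_left (minpoly.not_isUnit _ _) |>.symm
  have hdvd' : E ∣ S := hassoc.symm.dvd.trans (minpoly.isIntegrallyClosed_dvd hint hSy)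
  rw [← hdeg]
  exact natDegree_le_of_dvd hdvd' hS

theorem transcendental_sqBinomSeries_int : Transcendental ℤ[X] (sqBinomSeries ℤ) := by
  rintro ⟨P, hP, hP0⟩
  set c : ℤ := P.leadingCoeff.leadingCoeff with hc
  have hc0 : c ≠ 0 := by simpa [hc] using hP
  -- The prime exceeds |c|, so the equation survives reduction; it exceeds deg P + 1, for the final
  -- contradiction; and it is at least 5, so that 2 and 4 are invertible.
  obtain ⟨p, hpl, hp⟩ := Nat.exists_infinite_primes (c.natAbs + P.natDegree + 5)
  have : Fact p.Prime := ⟨hp⟩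
  let k := AlgebraicClosure (ZMod p)
  have : CharP k p := inferInstance
  have hcast : ∀ l : ℕ, 0 < l → l < p → (l : k) ≠ 0 := fun l h0 hl h =>
    absurd (Nat.le_of_dvd h0 ((CharP.cast_eq_zero_iff k p l).1 h)) (by omega)
  let ψ := Int.castRingHom k
  set P' : k[X][X] := P.map (mapRingHom ψ) with hP'
  have hP'0 : P' ≠ 0 := by
    intro h
    have h1 := congrArg (fun R => (R.coeff P.natDegree).coeff P.leadingCoeff.natDegree) h
    simp only [hP', coeff_map, coe_mapRingHom, coeff_zero] at h1
    change ψ c = 0 at h1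
    have h2 : ((c.natAbs : ℕ) : k) = 0 := by
      rcases Int.natAbs_eq c with e | e
      · rw [e] at h1
        simpa [ψ] using h1
      · rw [e] at h1
        simpa [ψ] using h1
    exact hcast _ (Int.natAbs_pos.2 hc0) (by omega) h2
  have hP'y : aeval (sqBinomSeries k) P' = 0 := by
    have hmap : PowerSeries.map ψ (sqBinomSeries ℤ) = sqBinomSeries k := by
      ext n
      simp [sqBinomSeries]
    rw [← hmap, hP', ← map_aeval_eq_aeval_map, hP0, map_zero]
    ext f n <;> simp [PowerSeries.algebraMap_apply']
  have hdeg' : P'.natDegree ≤ P.natDegree := natDegree_map_le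
  set T := PowerSeries.trunc p (sqBinomSeries k) with hT
  have hTK := trunc_sqBinomSeries_mul_pow k p (by omega)
  have hcoeff : ∀ n, T.coeff n = if n < p then (sqBinom n : k) else 0 := fun n => by
    rw [hT, PowerSeries.coeff_trunc]
    simp [sqBinomSeries]
  have hT2 : T.coeff 2 ≠ 0 := by
    rw [hcoeff, if_pos (by omega), show sqBinom 2 = 4 by decide]
    exact hcast 4 (by omega) (by omega)
  have hTdeg : T.natDegree < p := by
    have h : ∀ m, 0 < m → (PowerSeries.trunc m (sqBinomSeries k)).natDegree < m := by
      rintro (_ | m) hm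
      · omega
      · exact PowerSeries.natDegree_trunc_lt _ _
    exact h p hp.pos
  obtain ⟨α, hα⟩ := IsAlgClosed.exists_root T (by
    intro h
    exact hT2 (coeff_eq_zero_of_degree_lt (by rw [h]; norm_num)))
  have hα' : (derivative T).eval α ≠ 0 := by
    refine derivative_ne_zero_of_ode (derivative_trunc_sqBinomSeries k p (by omega))
      (fun h => hT2 (by rw [show T = 0 from h, coeff_zero])) hTdeg hα fun h => ?_
    have h2 : (2 : k) ≠ 0 := by exact_mod_cast hcast 2 (by omega) (by omega)
    simp at h ⊢
    intro h'
    -- The zeros of D = X - 16X³ are simple: D' = 1 - 48X² equals 1 at 0 and -2 where 16α² = 1.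
    have h3 : α * (1 - 16 * α ^ 2) = 0 := by linear_combination h
    rcases mul_eq_zero.1 h3 with h4 | h4
    · rw [h4] at h'
      simp at h'
    · exact h2 (by linear_combination 3 * h4 - h')
  let y : PowerSeries k := (sqBinomSeries k)⁻¹
  have hKc : PowerSeries.constantCoeff (sqBinomSeries k) ≠ 0 := by
    simp [sqBinomSeries, sqBinom]
  have hy : y * sqBinomSeries k = 1 := PowerSeries.inv_mul_cancel _ hKc
  have hyp : y ^ (p - 1) = T := by
    calc y ^ (p - 1) = y ^ (p - 1) * (T * sqBinomSeries k ^ (p - 1)) := by rw [hTK, mul_one]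
      _ = (y * sqBinomSeries k) ^ (p - 1) * T := by ring
      _ = T := by rw [hy, one_pow, one_mul]
  -- The reversed polynomial annihilates the inverse y = 1/K, which, unlike K, is the root of a
  -- monic binomial over k[X].
  have hrev : aeval y P'.reverse = 0 := by
    let : Invertible (sqBinomSeries k) := ⟨y, hy, by rw [mul_comm, hy]⟩
    exact (eval₂_reverse_eq_zero_iff _ _ _).2 hP'y
  have := le_natDegree_of_aeval_eq_zero hα hα' (by omega) hyp
    (fun h => hP'0 (by simpa using h)) hrev
  have := P'.reverse_natDegree_le
  omega

/-- Denominators are cleared: ℚ[X] is a localization of ℤ[X], hence algebraic over it. -/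
theorem transcendental_sqBinomSeries : Transcendental ℚ[X] (sqBinomSeries ℚ) := by
  intro h
  let := Polynomial.algebra ℤ ℚ
  have : IsScalarTower ℤ[X] ℚ[X] (PowerSeries ℚ) := IsScalarTower.of_algebraMap_eq fun f => by
    ext n
    simp [PowerSeries.algebraMap_apply', Polynomial.algebraMap_def]
  have : IsLocalization ((nonZeroDivisors ℤ).map (C : ℤ →+* ℤ[X])) ℚ[X] :=
    Polynomial.isLocalization _ _
  have : Algebra.IsAlgebraic ℤ[X] ℚ[X] := by
    refine ⟨fun f => ?_⟩
    obtain ⟨⟨m, s⟩, hs⟩ := IsLocalization.surj ((nonZeroDivisors ℤ).map (C : ℤ →+* ℤ[X])) f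
    have hs0 : (s : ℤ[X]) ≠ 0 := by
      obtain ⟨c, hc, hcs⟩ := s.2
      rw [← hcs]
      exact C_ne_zero.2 (nonZeroDivisors.ne_zero hc)
    refine ⟨C (s : ℤ[X]) * X - C m, fun h => hs0 ?_, ?_⟩
    · have := congrArg (fun P => P.coeff 1) h
      simpa using this
    · simp only [map_sub, map_mul, aeval_C, aeval_X]
      rw [mul_comm, hs, sub_self]
  obtain ⟨P, hP, hP0⟩ := h.restrictScalars ℤ[X]
  refine transcendental_sqBinomSeries_int ⟨P, hP, ?_⟩
  have hinj : Function.Injective (PowerSeries.map (Int.castRingHom ℚ)) := fun a b hab => by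
    ext n
    have := congrArg (PowerSeries.coeff n) hab
    simpa using this
  apply hinj
  rw [map_zero, ← hP0]
  have hmap : PowerSeries.map (Int.castRingHom ℚ) (sqBinomSeries ℤ) = sqBinomSeries ℚ := by
    ext n
    simp [sqBinomSeries]
  rw [← hmap, aeval_def, aeval_def, hom_eval₂]
  congr 1

end GouyouBeauchamps

/-! ### Operations preserving algebraicity and the three generating functions -/

namespace GouyouBeauchamps

open Polynomial

theorem exists_derivative_aeval_eq (F : PowerSeries ℚ) (P : ℚ[X][X]) :
    ∃ R : ℚ[X][X], PowerSeries.derivative ℚ (aeval F P) =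
      aeval F R + aeval F (derivative P) * PowerSeries.derivative ℚ F := by
  induction P using Polynomial.induction_on' with
  | add P P' h h' =>
    obtain ⟨R, hR⟩ := h
    obtain ⟨R', hR'⟩ := h'
    refine ⟨R + R', ?_⟩
    simp only [map_add, hR, hR']
    ring
  | monomial n c =>
    -- By the chain rule, R is P with its coefficients differentiated.
    refine ⟨monomial n (derivative c), ?_⟩
    have hc : ∀ f : ℚ[X], algebraMap ℚ[X] (PowerSeries ℚ) f = f := fun f => by
      simp [PowerSeries.algebraMap_apply']
    have hn : ((n : ℚ[X]) : PowerSeries ℚ) = n := map_natCast coeToPowerSeries.ringHom n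
    rw [derivative_monomial, aeval_monomial, aeval_monomial, aeval_monomial, hc, hc, hc,
      Derivation.leibniz, Derivation.leibniz_pow, PowerSeries.derivative_coe]
    simp only [smul_eq_mul, nsmul_eq_mul, coe_mul, hn]
    ring

theorem isAlgebraic_aeval {F : PowerSeries ℚ} (hF : IsAlgebraic ℚ[X] F) (R : ℚ[X][X]) :
    IsAlgebraic ℚ[X] (aeval F R) :=
  Algebra.isAlgebraic_adjoin_singleton_iff.mpr hF _ (aeval_mem_adjoin_singleton _ _)

theorem IsAlgebraic.derivative {F : PowerSeries ℚ} (hF : IsAlgebraic ℚ[X] F) :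
    IsAlgebraic ℚ[X] (PowerSeries.derivative ℚ F) := by
  have key : ∀ n : ℕ, ∀ P : ℚ[X][X], P.natDegree = n → P ≠ 0 → aeval F P = 0 →
      IsAlgebraic ℚ[X] (PowerSeries.derivative ℚ F) := by
    intro n
    induction n using Nat.strong_induction_on with
    | _ n ih =>
      intro P hn hP hP0
      -- Differentiating P(F) = 0 expresses P'(F) F' through F, which suffices if P'(F) ≠ 0.
      -- Otherwise P' is an annihilating polynomial of smaller degree, nonzero in characteristic 0.
      by_cases h1 : aeval F (Polynomial.derivative P) = 0
      · by_cases h2 : P.natDegree = 0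
        · exfalso
          rw [eq_C_of_natDegree_eq_zero h2, aeval_C, PowerSeries.algebraMap_apply'] at hP0
          have h3 : P.coeff 0 = 0 := by simpa using hP0
          apply hP
          rw [eq_C_of_natDegree_eq_zero h2, h3, C_0]
        · exact ih _ (hn ▸ natDegree_derivative_lt h2) _ rfl
            (fun h => h2 (Polynomial.derivative_eq_zero.1 h)) h1
      · obtain ⟨R, hR⟩ := exists_derivative_aeval_eq F P
        rw [hP0, map_zero] at hR
        refine IsAlgebraic.of_mul (mem_nonZeroDivisors_of_ne_zero h1) (isAlgebraic_aeval hF _) ?_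
        rw [show aeval F (Polynomial.derivative P) * PowerSeries.derivative ℚ F = -aeval F R by
          linear_combination -hR]
        exact (isAlgebraic_aeval hF R).neg
  obtain ⟨P, hP, hP0⟩ := hF
  exact key _ P rfl hP hP0

theorem IsAlgebraic.rescale_neg_one {F : PowerSeries ℚ} (hF : IsAlgebraic ℚ[X] F) :
    IsAlgebraic ℚ[X] (PowerSeries.rescale (-1) F) := by
  refine hF.ringHom_of_comp_eq (compRingHom (-X)) (PowerSeries.rescale (-1)) ?_ ?_
  · intro a b h
    have := congrArg (fun f : ℚ[X] => f.comp (-X)) h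
    simpa [comp_assoc] using this
  · ext : 1
    · ext c n
      rcases n with _ | n <;> simp [PowerSeries.algebraMap_apply', PowerSeries.coeff_C]
    · simp [PowerSeries.algebraMap_apply', PowerSeries.rescale_X]

/-- The even power series `∑ a(m) X^(2m)`. -/
noncomputable def evenSeries (a : ℕ → ℚ) : PowerSeries ℚ :=
  PowerSeries.mk fun n => if Even n then a (n / 2) else 0

theorem isAlgebraic_const_mul {F : PowerSeries ℚ} (hF : IsAlgebraic ℚ[X] F) (c : ℚ) :
    IsAlgebraic ℚ[X] (PowerSeries.C c * F) := by
  have h := (isAlgebraic_algebraMap (R := ℚ[X]) (A := PowerSeries ℚ) (C c)).mul hF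
  simpa [PowerSeries.algebraMap_apply'] using h

theorem isAlgebraic_X_mul {F : PowerSeries ℚ} (hF : IsAlgebraic ℚ[X] F) :
    IsAlgebraic ℚ[X] (PowerSeries.X * F) := by
  have h := (isAlgebraic_algebraMap (R := ℚ[X]) (A := PowerSeries ℚ) X).mul hF
  simpa [PowerSeries.algebraMap_apply'] using h

/-- The even part is (F(X) + F(-X))/2. -/
theorem isAlgebraic_evenSeries_coeff {F : PowerSeries ℚ} (hF : IsAlgebraic ℚ[X] F) :
    IsAlgebraic ℚ[X] (evenSeries fun m => PowerSeries.coeff (2 * m) F) := by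
  have h := isAlgebraic_const_mul (hF.add (IsAlgebraic.rescale_neg_one hF)) (1 / 2)
  refine (congrArg (IsAlgebraic ℚ[X]) (PowerSeries.ext fun n => ?_)).mpr h
  rw [PowerSeries.coeff_C_mul, map_add, PowerSeries.coeff_rescale, evenSeries,
    PowerSeries.coeff_mk]
  rcases Nat.even_or_odd n with hn | hn
  · rw [if_pos hn, hn.neg_one_pow, Nat.two_mul_div_two_of_even hn]
    ring
  · rw [if_neg (Nat.not_even_iff_odd.2 hn), hn.neg_one_pow]
    ring

/-- The operator (X/2) d/dX + c multiplies the coefficient of X^(2m) by m + c. -/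
theorem isAlgebraic_evenSeries_add_mul {a : ℕ → ℚ} (h : IsAlgebraic ℚ[X] (evenSeries a)) (c : ℚ) :
    IsAlgebraic ℚ[X] (evenSeries fun m => (m + c) * a m) := by
  have h := (isAlgebraic_const_mul (isAlgebraic_X_mul (IsAlgebraic.derivative h)) (1 / 2)).add
    (isAlgebraic_const_mul h c)
  refine (congrArg (IsAlgebraic ℚ[X]) (PowerSeries.ext fun n => ?_)).mpr h
  rw [map_add, PowerSeries.coeff_C_mul, PowerSeries.coeff_C_mul]
  have h1 : PowerSeries.coeff n (PowerSeries.X * PowerSeries.derivative ℚ (evenSeries a)) =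
      n * PowerSeries.coeff n (evenSeries a) := by
    rcases n with _ | n
    · simp
    · rw [PowerSeries.coeff_succ_X_mul, PowerSeries.coeff_derivative]
      push_cast
      ring
  rw [h1]
  simp only [evenSeries, PowerSeries.coeff_mk]
  rcases Nat.even_or_odd' n with ⟨m, rfl | rfl⟩
  · simp
    ring
  · rw [if_neg (by simp [parity_simps]), if_neg (by simp [parity_simps])]
    ring

theorem isAlgebraic_evenSeries_shift {a : ℕ → ℚ} (h : IsAlgebraic ℚ[X] (evenSeries a)) :
    IsAlgebraic ℚ[X] (evenSeries fun m => if m = 0 then 0 else a (m - 1)) := by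
  have h := isAlgebraic_X_mul (isAlgebraic_X_mul h)
  refine (congrArg (IsAlgebraic ℚ[X]) (PowerSeries.ext fun n => ?_)).mpr h
  rcases n with _ | _ | n
  · simp [evenSeries]
  · rw [PowerSeries.coeff_succ_X_mul]
    simp [evenSeries]
  · rw [PowerSeries.coeff_succ_X_mul, PowerSeries.coeff_succ_X_mul]
    simp [evenSeries, parity_simps, show (n + 1 + 1) / 2 - 1 = n / 2 by omega]

/-- Write b(m) = binom(2m,m)² and a(m) = (2m+1) b(m). Since 16(2m-1)² b(m-1) = 4m² b(m), the
combination `h3` has coefficients (4m² - (2m+1)² + 2(2m+1)) b(m) = b(m). Thus algebraicity of the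
series of a would imply that of K. -/
theorem transcendental_evenSeries_of_centralBinom :
    Transcendental ℚ[X] (evenSeries fun m => (2 * m + 1) * (m.centralBinom : ℚ) ^ 2) := by
  intro h
  have h1 := isAlgebraic_const_mul (isAlgebraic_evenSeries_add_mul h (1 / 2)) 2
  have h2 := isAlgebraic_const_mul (isAlgebraic_evenSeries_shift
    (isAlgebraic_evenSeries_add_mul h (1 / 2))) 32
  have h3 := (h2.sub h1).add (isAlgebraic_const_mul h 2)
  refine transcendental_sqBinomSeries ?_
  refine (congrArg (IsAlgebraic ℚ[X]) (PowerSeries.ext fun n => ?_)).mpr h3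
  simp only [map_add, map_sub, PowerSeries.coeff_C_mul, evenSeries, sqBinomSeries,
    PowerSeries.coeff_mk]
  rcases Nat.even_or_odd' n with ⟨m, rfl | rfl⟩
  · rw [sqBinom_two_mul]
    simp only [even_two, Even.mul_right, if_true, Nat.mul_div_cancel_left _ two_pos]
    rcases m with _ | m
    · norm_num
    · rw [if_neg (Nat.succ_ne_zero m), Nat.add_sub_cancel]
      have h4 := congrArg (Nat.cast (R := ℚ)) (Nat.succ_mul_centralBinom_succ m)
      push_cast at h4 ⊢
      linear_combination (4 * (m + 1) * ((m + 1).centralBinom : ℚ) +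
        4 * (2 * (2 * m + 1) * (m.centralBinom : ℚ))) * h4
  · rw [sqBinom_of_odd (by simp [parity_simps])]
    simp [parity_simps]

theorem centralBinom_cast (m : ℕ) : (m.centralBinom : ℚ) = (2 * m)! / (m ! : ℚ) ^ 2 := by
  have h := Nat.choose_mul_factorial_mul_factorial (show m ≤ 2 * m by omega)
  rw [show 2 * m - m = m by omega] at h
  have hm : (m ! : ℚ) ≠ 0 := by exact_mod_cast (Nat.factorial_pos m).ne'
  rw [eq_div_iff (pow_ne_zero 2 hm), ← h, Nat.centralBinom]
  push_cast
  ring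

/-- Multiplying the even coefficients by (m+1)² yields (2m+1) binom(2m,m)². -/
theorem transcendental_of_coeff_two_mul_eq_qTot {F : PowerSeries ℚ}
    (hF : ∀ m, PowerSeries.coeff (2 * m) F = qTot (2 * m)) : Transcendental ℚ[X] F := by
  intro h
  have h1 := isAlgebraic_evenSeries_add_mul (isAlgebraic_evenSeries_add_mul
    (isAlgebraic_evenSeries_coeff h) 1) 1
  refine transcendental_evenSeries_of_centralBinom ?_
  convert h1 using 3 with m
  have hm : (m ! : ℚ) ≠ 0 := by exact_mod_cast (Nat.factorial_pos m).ne'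
  rw [hF, qTot_even_eq, centralBinom_cast, Nat.factorial_succ (2 * m), Nat.factorial_succ m]
  push_cast
  field_simp

/-- Multiplying the even coefficients by (m+1)²(m+2)/2 yields (2m+1) binom(2m,m)². -/
theorem transcendental_of_coeff_two_mul_eq_qAbs {F : PowerSeries ℚ}
    (hF : ∀ m, PowerSeries.coeff (2 * m) F = qAbs 0 (2 * m)) : Transcendental ℚ[X] F := by
  intro h
  have h1 := isAlgebraic_const_mul (isAlgebraic_evenSeries_add_mul (isAlgebraic_evenSeries_add_mul
    (isAlgebraic_evenSeries_add_mul (isAlgebraic_evenSeries_coeff h) 1) 1) 2) (1 / 2)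
  refine transcendental_evenSeries_of_centralBinom ?_
  refine (congrArg (IsAlgebraic ℚ[X]) (PowerSeries.ext fun n => ?_)).mpr h1
  rw [PowerSeries.coeff_C_mul]
  simp only [evenSeries, PowerSeries.coeff_mk]
  split_ifs
  · generalize n / 2 = m
    have hm : (m ! : ℚ) ≠ 0 := by exact_mod_cast (Nat.factorial_pos m).ne'
    rw [hF, qAbs_zero_eq, centralBinom_cast, Nat.factorial_succ (2 * m + 1),
      Nat.factorial_succ (2 * m), Nat.factorial_succ (m + 1), Nat.factorial_succ m]
    push_cast
    rw [show (m : ℚ) + 1 + 1 = m + 2 by ring]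
    field_simp
    ring
  · ring

theorem coeff_QAt (a b : ℚ) (n : ℕ) : PowerSeries.coeff n (QAt a b) =
    ∑ i ∈ Finset.range (n + 1), ∑ j ∈ Finset.range (n + 1), (q i j n : ℚ) * a ^ i * b ^ j := by
  simp [QAt, Q]

theorem coeff_QAt_one_one (n : ℕ) : PowerSeries.coeff n (QAt 1 1) = qTot n := by
  rw [coeff_QAt, qTot_eq_sum, Finset.sum_product]
  push_cast
  simp

theorem coeff_QAt_zero_one (n : ℕ) : PowerSeries.coeff n (QAt 0 1) = qAbs 0 n := by
  rw [coeff_QAt, qAbs_eq_sum, Finset.sum_eq_single 0]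
  · push_cast
    simp
  · intro i _ hi
    simp [hi]
  · simp

theorem coeff_QAt_one_zero (n : ℕ) : PowerSeries.coeff n (QAt 1 0) = qOrd 0 n := by
  rw [coeff_QAt, qOrd_eq_sum]
  push_cast
  refine Finset.sum_congr rfl fun i _ => ?_
  rw [Finset.sum_eq_single 0]
  · simp
  · intro j _ hj
    simp [hj]
  · simp

end GouyouBeauchamps

open GouyouBeauchamps

theorem mainTheorem5 :
    -- `q(i,j;n)` is Gosper-summable in `i` (for each parity of `n`) and in `j`
    (GosperSummableIn 2 (fun v : Fin 3 → ℕ => (q (2 * v 2) (v 1) (2 * v 0) : ℚ)) ∧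
      GosperSummableIn 2 (fun v : Fin 3 → ℕ => (q (2 * v 2 + 1) (v 1) (2 * v 0 + 1) : ℚ)) ∧
      GosperSummableIn 2 (fun v : Fin 3 → ℕ => (q (v 1) (v 2) (2 * v 0 + v 1) : ℚ))) ∧
    -- hence closed forms for the sums of `q(i,j;n)` over an interval of `i` or of `j`
    ((∃ g : (Fin 3 → ℕ) → ℚ, IsHypergeometricTerm g ∧ ∀ m j i₀ i₁ : ℕ, i₀ ≤ i₁ →
        ∑ i ∈ Finset.Icc i₀ i₁, (q i j (2 * m) : ℚ) =
          g ![m, j, i₁ / 2 + 1] - g ![m, j, (i₀ + 1) / 2]) ∧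
      (∃ g : (Fin 3 → ℕ) → ℚ, IsHypergeometricTerm g ∧ ∀ m j i₀ i₁ : ℕ, i₀ ≤ i₁ →
        ∑ i ∈ Finset.Icc i₀ i₁, (q i j (2 * m + 1) : ℚ) =
          g ![m, j, (i₁ + 1) / 2] - g ![m, j, i₀ / 2]) ∧
      (∃ g : (Fin 3 → ℕ) → ℚ, IsHypergeometricTerm g ∧ ∀ m i j₀ j₁ : ℕ, j₀ ≤ j₁ →
        ∑ j ∈ Finset.Icc j₀ j₁, (q i j (2 * m + i) : ℚ) =
          g ![m, i, j₁ + 1] - g ![m, i, j₀])) ∧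
    -- walks ending at ordinate `j`
    (∀ j n : ℕ, HasSum (fun i => q i j n) (qOrd j n)) ∧
    (∀ j m : ℕ, (qOrd j (2 * m) : ℚ) =
      if j ≤ m then ((j + 1) * (2 * m)! * (2 * m + 2)! : ℚ) /
        ((m - j)! * (m + 1)! ^ 2 * (m + j + 2)!) else 0) ∧
    (∀ j m : ℕ, (qOrd j (2 * m + 1) : ℚ) =
      if j ≤ m then (2 * (j + 1) * (2 * m + 1)! * (2 * m + 2)! : ℚ) /
        ((m - j)! * (m + 1)! * (m + 2)! * (m + j + 2)!) else 0) ∧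
    -- walks ending at abscissa `i`
    (∀ i n : ℕ, HasSum (fun j => q i j n) (qAbs i n)) ∧
    (∀ i m : ℕ, (qAbs i (2 * m + i) : ℚ) =
      ((i + 1) * (2 * m + i)! * (2 * m + i + 2)! : ℚ) /
        (m ! * (m + 1)! * (m + i + 1)! * (m + i + 2)!)) ∧
    -- walks of even length ending on the axes
    (∀ m : ℕ, qOrd 0 (2 * m) = qAbs 0 (2 * m) ∧
      (qAbs 0 (2 * m) : ℚ) =
        ((2 * m)! * (2 * m + 2)! : ℚ) / (m ! * (m + 1)! ^ 2 * (m + 2)!)) ∧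
    -- `q(i,-;n)` and `q(-,j;n)` are Gosper-summable in `i` and `j` (for each parity of `n`)
    (GosperSummableIn 1 (fun v : Fin 2 → ℕ => (qAbs (2 * v 1) (2 * v 0) : ℚ)) ∧
      GosperSummableIn 1 (fun v : Fin 2 → ℕ => (qAbs (2 * v 1 + 1) (2 * v 0 + 1) : ℚ)) ∧
      GosperSummableIn 1 (fun v : Fin 2 → ℕ => (qOrd (v 1) (2 * v 0) : ℚ)) ∧
      GosperSummableIn 1 (fun v : Fin 2 → ℕ => (qOrd (v 1) (2 * v 0 + 1) : ℚ))) ∧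
    -- hence closed forms for their sums over an interval
    ((∃ g : (Fin 2 → ℕ) → ℚ, IsHypergeometricTerm g ∧ ∀ m i₀ i₁ : ℕ, i₀ ≤ i₁ →
        ∑ i ∈ Finset.Icc i₀ i₁, (qAbs i (2 * m) : ℚ) =
          g ![m, i₁ / 2 + 1] - g ![m, (i₀ + 1) / 2]) ∧
      (∃ g : (Fin 2 → ℕ) → ℚ, IsHypergeometricTerm g ∧ ∀ m i₀ i₁ : ℕ, i₀ ≤ i₁ →
        ∑ i ∈ Finset.Icc i₀ i₁, (qAbs i (2 * m + 1) : ℚ) =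
          g ![m, (i₁ + 1) / 2] - g ![m, i₀ / 2]) ∧
      (∃ g : (Fin 2 → ℕ) → ℚ, IsHypergeometricTerm g ∧ ∀ m j₀ j₁ : ℕ, j₀ ≤ j₁ →
        ∑ j ∈ Finset.Icc j₀ j₁, (qOrd j (2 * m) : ℚ) = g ![m, j₁ + 1] - g ![m, j₀]) ∧
      (∃ g : (Fin 2 → ℕ) → ℚ, IsHypergeometricTerm g ∧ ∀ m j₀ j₁ : ℕ, j₀ ≤ j₁ →
        ∑ j ∈ Finset.Icc j₀ j₁, (qOrd j (2 * m + 1) : ℚ) = g ![m, j₁ + 1] - g ![m, j₀])) ∧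
    -- the total number of walks
    (∀ n : ℕ, HasSum (fun p : ℕ × ℕ => q p.1 p.2 n) (qTot n)) ∧
    (∀ m : ℕ, (qTot (2 * m) : ℚ) =
      ((2 * m)! * (2 * m + 1)! : ℚ) / (m ! ^ 2 * (m + 1)! ^ 2)) ∧
    (∀ m : ℕ, (qTot (2 * m + 1) : ℚ) =
      ((2 * m + 1)! * (2 * m + 2)! : ℚ) / (m ! * (m + 1)! ^ 2 * (m + 2)!)) ∧
    -- asymptotics; `q(0,-;n)` vanishes when `n` is odd
    (∃ c₁ > (0 : ℝ), Asymptotics.IsEquivalent Filter.atTop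
      (fun n : ℕ => (qTot n : ℝ)) (fun n : ℕ => c₁ * (4 ^ n / (n : ℝ) ^ 2))) ∧
    (∃ c₂ > (0 : ℝ), Asymptotics.IsEquivalent Filter.atTop
      (fun m : ℕ => (qAbs 0 (2 * m) : ℝ))
      (fun m : ℕ => c₂ * (4 ^ (2 * m) / ((2 * m : ℕ) : ℝ) ^ 3))) ∧
    (∃ c₃ > (0 : ℝ), Asymptotics.IsEquivalent Filter.atTop
      (fun n : ℕ => (qOrd 0 n : ℝ)) (fun n : ℕ => c₃ * (4 ^ n / (n : ℝ) ^ 3))) ∧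
    -- transcendence over `ℚ(t)`
    Transcendental (Polynomial ℚ) (QAt 1 1) ∧
    Transcendental (Polynomial ℚ) (QAt 0 1) ∧
    Transcendental (Polynomial ℚ) (QAt 1 0) := by
  refine ⟨⟨gosperSummableIn_q_even, gosperSummableIn_q_odd, gosperSummableIn_q_ord⟩,
    ⟨⟨_, isHypergeometricTerm_tailEvenAbs, fun m j _ _ h => sum_q_even m j h⟩,
      ⟨_, isHypergeometricTerm_tailOddAbs, fun m j _ _ h => sum_q_odd m j h⟩,
      ⟨_, isHypergeometricTerm_tailOrd, fun m i _ _ h => sum_q_ord m i h⟩⟩,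
    hasSum_qOrd, qOrd_even_eq, qOrd_odd_eq, hasSum_qAbs, qAbs_eq,
    fun m => ⟨qOrd_zero_eq_qAbs_zero m, qAbs_zero_eq m⟩,
    ⟨gosperSummableIn_qAbs_even, gosperSummableIn_qAbs_odd, gosperSummableIn_qOrd_even,
      gosperSummableIn_qOrd_odd⟩,
    ⟨⟨_, isHypergeometricTerm_tailAbsEven, fun m _ _ h => sum_qAbs_even m h⟩,
      ⟨_, isHypergeometricTerm_tailAbsOdd, fun m _ _ h => sum_qAbs_odd m h⟩,
      ⟨_, isHypergeometricTerm_tailOrdEven, fun m _ _ h => sum_qOrd_even m h⟩,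
      ⟨_, isHypergeometricTerm_tailOrdOdd, fun m _ _ h => sum_qOrd_odd m h⟩⟩,
    hasSum_qTot, qTot_even_eq, qTot_odd_eq,
    ⟨8 / Real.pi, by positivity, qTot_isEquivalent⟩,
    ⟨32 / Real.pi, by positivity, qAbs_zero_isEquivalent⟩,
    ⟨32 / Real.pi, by positivity, qOrd_zero_isEquivalent⟩,
    transcendental_of_coeff_two_mul_eq_qTot fun m => coeff_QAt_one_one _,
    transcendental_of_coeff_two_mul_eq_qAbs fun m => coeff_QAt_zero_one _,
    transcendental_of_coeff_two_mul_eq_qAbs fun m => ?_⟩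
  -- Q(1,0;t) also has odd terms, but only its even coefficients matter, and these agree with those
  -- of Q(0,1;t).
  rw [coeff_QAt_one_zero, qOrd_zero_eq_qAbs_zero]
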